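/- **Setting.** Let $F$ be a nonarchimedean local field of residual characteristic $2$ (of characteristic $0$ or $2$), with ring of integers $\mathcal R$, maximal ideal $\mathcal P$, residue field $\mathfrak f=\mathcal R/\mathcal P$ of order $q$, and a fixed uniformizer $\varpi$. Let $e\in\{1,2,\dots\}\cup\{\infty\}$ be the valuation of $2$, i.e. $2\in\varpi^e\mathcal R^\times$ if $\operatorname{char}F=0$, and $e=\infty$ if $\operatorname{char}F=2$ (so that $m<2e$ always holds and $m=2e$ never holds for an integer $m$). Let $\mathcal K'=\mathrm{SL}(2,\mathcal R)\subset \mathrm{GL}(2,F)$ and, for $\ell\ge 1$, let $B'_\ell\subset\mathcal K'$ be the subgroup of matrices that are lower triangular modulo $\mathcal P^\ell$. Put $$g_\ell=\begin{bmatrix}\varpi^\ell&0\\0&1\end{bmatrix},\qquad w=\begin{bmatrix}0&1\\-1&0\end{bmatrix},\qquad g(k,\alpha)=\begin{bmatrix}1&\alpha\varpi^k\\0&1\end{bmatrix}.$$ For a subgroup $H$ of $\mathrm{GL}(2,F)$, $g\in \mathrm{GL}(2,F)$ and a representation $\rho$ of $H$, write ${}^gH=gHg^{-1}$ and let ${}^g\rho$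 be the representation $x\mapsto\rho(g^{-1}xg)$ of ${}^gH$. Let $\sigma$ be the inflation to $\mathcal K'$ of a cuspidal representation of $\mathrm{SL}(2,\mathfrak f)$, that is, of an irreducible complex representation without nonzero vectors fixed by the unipotent upper triangular subgroup. Since $B'_\ell\subset{}^{g_\ell}\mathcal K'$, the representation ${}^{g_\ell}\sigma$ restricts to $B'_\ell$, and ${}^{\gamma g_\ell}\sigma={}^\gamma({}^{g_\ell}\sigma)$ restricts to ${}^\gamma B'_\ell$ for $\gamma\in\mathcal K'$. For $1\le k<\ell$ let $\mathcal S_{\ell,k}\subset\mathcal R^\times$ be a set of representatives of $\mathcal R^\times/(\mathcal R^\times)^2(1+\mathcal P^{\min\{\ell-k,k\}})$. The double cosets in $B'_\ell\backslash\mathcal K'/B'_\ell$ are represented by the elements of $$\mathscr S_\ell=\{I,w\}\cup\bigcup_{1\le k<\ell}\{g(k,\alpha)\mid\alpha\in\mathcal S_{\ell,k}\}.$$ **Theorem 5.5.** Let $\ell\geq 1$ and $\gamma\in\mathscr S_\ell$. Then $$\dim_{\mathbb C}\operatorname{Hom}_{{}^\gamma B'_\ell\cap B'_\ell}\bigl({}^{g_\ell}\sigma,\,{}^{\gamma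 g_\ell}\sigma\bigr)=\begin{cases} 1 & \text{if }\gamma=I;\\ q-1 & \text{if }\gamma=g(k,\alpha)\text{ with }2k>\ell\text{ and }\ell-k<2e\text{ odd};\\ 1 & \text{if }\gamma=g(k,\alpha)\text{ with }2k>\ell\text{ and }\ell-k=2e;\\ 0 & \text{otherwise.} \end{cases}$$ -/

import Mathlib

open scoped Pointwise MatrixGroups
open ValuativeRel

namespace DepthZero

section Representations

variable {G V : Type*} [Group G] [AddCommGroup V] [Module ℂ V]

/-- The restriction of a representation of `H` to a subgroup `J ≤ H`. -/
def resRep {J H : Subgroup G} (h : J ≤ H) (ρ : Representation ℂ H V) : Representation ℂ J V :=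
  ρ.comp (Subgroup.inclusion h)

/-- For a representation `ρ` of `H ≤ G` and `g : G`, the representation `ᵍρ` of `ᵍH = g H g⁻¹`
given by `ᵍρ(x) = ρ(g⁻¹ x g)`. -/
def conjRep (g : G) {H : Subgroup G} (ρ : Representation ℂ H V) :
    Representation ℂ (MulAut.conj g • H : Subgroup G) V :=
  ρ.comp (Subgroup.equivSMul (MulAut.conj g) H).symm.toMonoidHom

theorem conjRep_apply (g : G) {H : Subgroup G} (ρ : Representation ℂ H V)
    (x : (MulAut.conj g • H : Subgroup G)) (hx : g⁻¹ * (x : G) * g ∈ H) :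
    conjRep g ρ x = ρ ⟨g⁻¹ * (x : G) * g, hx⟩ := by
  have : x = Subgroup.equivSMul (MulAut.conj g) H ⟨g⁻¹ * (x : G) * g, hx⟩ := by
    apply Subtype.ext
    change (x : G) = g * (g⁻¹ * (x : G) * g) * g⁻¹
    group
  change ρ ((Subgroup.equivSMul (MulAut.conj g) H).symm x) = _
  rw [MulEquiv.symm_apply_eq _ |>.mpr this]

/-- For a representation `ρ` of `H ≤ G` and `g : G`, the space of intertwining operators
`Hom_{ᵍH ∩ H}(ρ, ᵍρ)`. -/
abbrev selfIntertwiners (g : G) {H : Subgroup G} (ρ : Representation ℂ H V) : Type _ :=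
  Representation.IntertwiningMap
    (resRep (inf_le_right : (MulAut.conj g • H) ⊓ H ≤ H) ρ)
    (resRep (inf_le_left : (MulAut.conj g • H) ⊓ H ≤ MulAut.conj g • H) (conjRep g ρ))

end Representations

/-- The unipotent upper triangular element with entry `x` of `SL(2, k)`. -/
def upperUnipotent {k : Type*} [CommRing k] (x : k) : SL(2, k) :=
  ⟨!![1, x; 0, 1], by simp [Matrix.det_fin_two_of]⟩

/-- A cuspidal representation of `SL(2, k)`, for a (finite) field `k`: an irreducible complex
representation without nonzero vectors fixed by the unipotent upper triangular subgroup, which is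
up to conjugacy the only unipotent radical of a proper parabolic subgroup. -/
structure IsCuspidal {k V : Type*} [Field k] [AddCommGroup V] [Module ℂ V]
    (σ : Representation ℂ SL(2, k) V) : Prop where
  irreducible : σ.IsIrreducible
  no_fixed : ∀ v : V, (∀ x : k, σ (upperUnipotent x) v = v) → v = 0

section LocalField

variable (F : Type*) [Field F] [ValuativeRel F] [TopologicalSpace F] [IsNonarchimedeanLocalField F]

/-- The exponent `e` with `2 = ι ϖᵉ`, `ι` a unit; it is `⊤` if `2 = 0` in `F`. -/
noncomputable def twoVal : ℕ∞ := IsDiscreteValuationRing.addVal 𝒪[F] 2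

/-- The maximal compact subgroup `𝒦' = SL(2, 𝓡)`, as a subgroup of `GL(2, F)`. -/
noncomputable def maxCompact : Subgroup (GL (Fin 2) F) :=
  (Matrix.SpecialLinearGroup.mapGL (R := 𝒪[F]) (n := Fin 2) F).range

variable {F}

/-- The matrices of `SL(2, 𝓡)` that are lower triangular modulo `𝓟^ℓ`. -/
def lowerModO (ℓ : ℕ) : Subgroup SL(2, 𝒪[F]) where
  carrier := {a | a 0 1 ∈ (𝓂[F] ^ ℓ : Ideal 𝒪[F])}
  mul_mem' := by
    intro a b ha hb
    simp only [Set.mem_ofPred_eq, Matrix.SpecialLinearGroup.coe_mul, Matrix.mul_apply,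
      Fin.sum_univ_two] at ha hb ⊢
    exact Ideal.add_mem _ (Ideal.mul_mem_left _ _ hb) (Ideal.mul_mem_right _ _ ha)
  one_mem' := by
    simp
  inv_mem' := by
    intro a ha
    simp only [Set.mem_ofPred_eq] at ha ⊢
    rw [Matrix.SpecialLinearGroup.coe_inv, Matrix.adjugate_fin_two]
    simpa using ha

variable (F) in
/-- The group `B'_ℓ` of matrices of `𝒦'` that are lower triangular modulo `𝓟^ℓ`, as a subgroup
of `GL(2, F)`. -/
noncomputable def lowerMod (ℓ : ℕ) : Subgroup (GL (Fin 2) F) :=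
  (lowerModO (F := F) ℓ).map (Matrix.SpecialLinearGroup.mapGL F)

theorem mapGL_injective :
    Function.Injective (Matrix.SpecialLinearGroup.mapGL (R := 𝒪[F]) (n := Fin 2) F) :=
  Matrix.SpecialLinearGroup.mapGL_injective

/-- Reduction modulo `𝓟`, as a homomorphism `𝒦' → SL(2, 𝔣)`. -/
noncomputable def reduction : maxCompact F →* SL(2, 𝓀[F]) :=
  (Matrix.SpecialLinearGroup.map (IsLocalRing.residue 𝒪[F])).comp
    (MonoidHom.ofInjective (mapGL_injective (F := F))).symm.toMonoidHom

theorem reduction_mapGL (a : SL(2, 𝒪[F])) :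
    reduction (F := F) ⟨Matrix.SpecialLinearGroup.mapGL F a, MonoidHom.mem_range.mpr ⟨a, rfl⟩⟩ =
      Matrix.SpecialLinearGroup.map (IsLocalRing.residue 𝒪[F]) a :=
  congrArg (Matrix.SpecialLinearGroup.map (IsLocalRing.residue 𝒪[F]))
    ((MonoidHom.ofInjective (mapGL_injective (F := F))).symm_apply_apply a)

/-- The inflation to `𝒦'` of a representation of `SL(2, 𝔣)`. -/
noncomputable def inflation {V : Type*} [AddCommGroup V] [Module ℂ V]
    (σ : Representation ℂ SL(2, 𝓀[F]) V) : Representation ℂ (maxCompact F) V :=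
  σ.comp reduction

/-- The matrix `g_ℓ = diag(ϖ^ℓ, 1)`. -/
noncomputable def gEll {ϖ : 𝒪[F]} (hϖ : Irreducible ϖ) (ℓ : ℕ) : GL (Fin 2) F :=
  Matrix.GeneralLinearGroup.mkOfDetNeZero !![(ϖ : F) ^ ℓ, 0; 0, 1] (by
    have : (ϖ : F) ≠ 0 := fun h => hϖ.ne_zero (Subtype.ext h)
    simp [Matrix.det_fin_two_of, this])

theorem lowerMod_le {ϖ : 𝒪[F]} (hϖ : Irreducible ϖ) (ℓ : ℕ) :
    lowerMod F ℓ ≤ MulAut.conj (gEll hϖ ℓ) • maxCompact F := by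
  rintro _ ⟨a, ha, rfl⟩
  have ha' : a 0 1 ∈ (𝓂[F] ^ ℓ : Ideal 𝒪[F]) := ha
  rw [hϖ.maximalIdeal_eq, Ideal.span_singleton_pow, Ideal.mem_span_singleton] at ha'
  obtain ⟨c, hc⟩ := ha'
  have hdet := a.det_coe
  rw [Matrix.det_fin_two, hc] at hdet
  have hb : (!![a 0 0, c; a 1 0 * ϖ ^ ℓ, a 1 1]).det = 1 := by
    rw [Matrix.det_fin_two_of]
    linear_combination hdet
  rw [Subgroup.mem_smul_pointwise_iff_exists]
  obtain ⟨b, hb'⟩ : ∃ b : SL(2, 𝒪[F]),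
    (b : Matrix (Fin 2) (Fin 2) 𝒪[F]) = !![a 0 0, c; a 1 0 * ϖ ^ ℓ, a 1 1] := ⟨⟨_, hb⟩, rfl⟩
  refine ⟨Matrix.SpecialLinearGroup.mapGL F b, MonoidHom.mem_range.mpr ⟨_, rfl⟩, ?_⟩
  rw [MulAut.smul_def, MulAut.conj_apply, mul_inv_eq_iff_eq_mul]
  have hc' : algebraMap 𝒪[F] F (a 0 1) = (ϖ : F) ^ ℓ * algebraMap 𝒪[F] F c := by
    rw [hc, map_mul, map_pow]; rfl
  have hϖ' : algebraMap 𝒪[F] F ϖ = (ϖ : F) := rfl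
  ext i j
  fin_cases i <;> fin_cases j <;>
    simp [gEll, Matrix.mul_apply, Fin.sum_univ_two, hc', hϖ', hb',
      Matrix.SpecialLinearGroup.mapGL_coe_matrix,
      Matrix.GeneralLinearGroup.mkOfDetNeZero, mul_comm]

/-- The representation `^{g_ℓ}σ`, restricted from `^{g_ℓ}𝒦'` to `B'_ℓ`. -/
noncomputable def twisted {V : Type*} [AddCommGroup V] [Module ℂ V]
    (σ : Representation ℂ SL(2, 𝓀[F]) V) {ϖ : 𝒪[F]} (hϖ : Irreducible ϖ) (ℓ : ℕ) :
    Representation ℂ (lowerMod F ℓ) V :=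
  resRep (lowerMod_le hϖ ℓ) (conjRep (gEll hϖ ℓ) (inflation σ))

variable (F) in
/-- The Weyl element `w`. -/
noncomputable def weyl : GL (Fin 2) F :=
  Matrix.SpecialLinearGroup.mapGL F
    (⟨!![0, 1; -1, 0], by simp [Matrix.det_fin_two_of]⟩ : SL(2, 𝒪[F]))

/-- The element `g(k, α)`, upper unipotent with entry `α ϖ^k`. -/
noncomputable def gK (ϖ : 𝒪[F]) (k : ℕ) (α : 𝒪[F]ˣ) : GL (Fin 2) F :=
  Matrix.SpecialLinearGroup.mapGL F (upperUnipotent ((α : 𝒪[F]) * ϖ ^ k))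

/-- The units `u`, `u'` represent the same square class modulo `𝓟^m`:
`u' ∈ u (𝓡ˣ)² (1 + 𝓟^m)`. -/
def SameSquareClass (m : ℕ) (u u' : 𝒪[F]ˣ) : Prop :=
  ∃ v : 𝒪[F]ˣ, ∃ p ∈ 𝓂[F] ^ m, (u' : 𝒪[F]) = u * v ^ 2 * (1 + p)

/-- `T` is a set of representatives in `𝓡ˣ` for the square classes modulo `𝓟^m`. -/
def IsSquareClassReps (m : ℕ) (T : Set 𝒪[F]ˣ) : Prop :=
  ∀ u : 𝒪[F]ˣ, ∃! t, t ∈ T ∧ SameSquareClass m t u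

/-- The set `𝒮_ℓ = {I, w} ∪ {g(k, α) : 1 ≤ k < ℓ, α ∈ S k}` of representatives of
`B'_ℓ \ 𝒦' / B'_ℓ`, where `S k` plays the role of `𝒮_{ℓ,k}`. -/
def cosetReps (ϖ : 𝒪[F]) (ℓ : ℕ) (S : ℕ → Set 𝒪[F]ˣ) : Set (GL (Fin 2) F) :=
  {1, weyl F} ∪ {γ | ∃ k, 1 ≤ k ∧ k < ℓ ∧ ∃ α ∈ S k, γ = gK ϖ k α}

end LocalField

end DepthZero

/-! Conjugation by $g_\ell^{-1}$ turns $h\in B'_\ell$ into a matrix `p` that is upper triangular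
modulo $\mathcal P$, so only the restriction of $\sigma$ to the Borel subgroup of
$\mathrm{SL}(2,\mathfrak f)$ matters. On the unipotent subgroup $U$, every nontrivial character
occurs in $\sigma$ exactly once (`exists_eigenbasis`): multiplicity one is a Gelfand-type argument,
and since squaring is bijective on $\mathfrak f$, the torus permutes these characters transitively.
Schur-type reasoning then gives dimension 1 for $\gamma=I$. For $\gamma=w$, all of $U$ acts on one
side against the identity on the other, which forces 0.

For $\gamma=g(k,\alpha)$ put $m=\ell-k$. The two reductions of an element of the intersection are
$u(x)$ and $u(x+z)$, where $x\in\mathfrak f$ is arbitrary and $z$ runs through a subgroup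
$Z\subset\mathfrak f$. An intertwiner is thus a $U$-map with image fixed by $u(Z)$, and the
dimension is the number $|\mathfrak f/Z|-1$ of nontrivial characters of $\mathfrak f/Z$
(`rank_relativeCommutant`, `conjIntertwiners_upperUnipotent`).

If $k\le m$, the lower left entry produces every $z$, so $Z=\mathfrak f$. If $k>m$, then $Z$
consists of the residues of $\alpha t$ with $s(s+2)=\varpi^m t$. For $m<2e$ odd, $s(s+2)$ is
divisible by $\varpi^{m+1}$ and $Z=0$. For $m=2N\le 2e$, write $s=\varpi^N r$ and $2=\varpi^N w$:
$Z$ is the image of $r\mapsto\alpha(r^2+wr)$, of index 2 when $w$ is a unit ($m=2e$) and everything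
when $\varpi\mid w$. For $m>2e$ the term $2s$ dominates and $Z=\mathfrak f$. -/

namespace DepthZero

/-! ### Explicit elements and the Bruhat decomposition of SL(2) over a field. -/

section SpecialLinear

variable {k : Type*} [Field k]

@[simp]
theorem coe_upperUnipotent {R : Type*} [CommRing R] (x : R) :
    (upperUnipotent x : Matrix (Fin 2) (Fin 2) R) = !![1, x; 0, 1] := rfl

theorem upperUnipotent_add (x y : k) :
    upperUnipotent (x + y) = upperUnipotent x * upperUnipotent y := by
  ext i j
  fin_cases i <;> fin_cases j <;>
    simp [Matrix.mul_apply, Fin.sum_univ_two, add_comm]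

theorem upperUnipotent_zero : upperUnipotent (0 : k) = 1 := by
  ext i j
  fin_cases i <;> fin_cases j <;> simp

/-- The antidiagonal element of `SL(2, k)` with lower left entry `c`. -/
def antidiag (c : kˣ) : SL(2, k) :=
  ⟨!![0, -↑c⁻¹; ↑c, 0], by simp [Matrix.det_fin_two_of]⟩

@[simp]
theorem coe_antidiag (c : kˣ) :
    (antidiag c : Matrix (Fin 2) (Fin 2) k) = !![0, -↑c⁻¹; ↑c, 0] := rfl

/-- The diagonal element `diag(t, t⁻¹)` of `SL(2, k)`. -/
def diagSL (t : kˣ) : SL(2, k) :=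
  ⟨!![↑t, 0; 0, ↑t⁻¹], by simp [Matrix.det_fin_two_of]⟩

@[simp]
theorem coe_diagSL (t : kˣ) :
    (diagSL t : Matrix (Fin 2) (Fin 2) k) = !![↑t, 0; 0, ↑t⁻¹] := rfl

theorem upperUnipotent_mul_diagSL (t : kˣ) (x : k) :
    upperUnipotent x * diagSL t = diagSL t * upperUnipotent (x * (↑t⁻¹) ^ 2) := by
  ext i j
  fin_cases i <;> fin_cases j <;>
    simp [Matrix.mul_apply, Fin.sum_univ_two]
  field_simp

/-- The Bruhat decomposition of an element of the big cell. -/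
theorem eq_mul_antidiag_mul (g : SL(2, k)) (c : kˣ) (hc : g 1 0 = c) :
    g = upperUnipotent (g 0 0 * ↑c⁻¹) * antidiag c * upperUnipotent (g 1 1 * ↑c⁻¹) := by
  have hd := g.det_coe
  rw [Matrix.det_fin_two, hc] at hd
  have hc0 := c.ne_zero
  ext i j
  fin_cases i <;> fin_cases j <;>
    simp [Matrix.mul_apply, Fin.sum_univ_two, hc]
  · field_simp
    linear_combination -hd
  · field_simp

theorem apply_neg_mul_self (ψ : AddChar k ℂ) (x : k) : ψ (-x) * ψ x = 1 := by
  rw [← AddChar.map_add_eq_mul, neg_add_cancel, AddChar.map_zero_eq_one]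

theorem sq_inj_of_charP_two [CharP k 2] {a b : k} (h : a ^ 2 = b ^ 2) : a = b := by
  have : (a - b) ^ 2 = 0 := by rw [sub_pow_char, h, sub_self]
  exact sub_eq_zero.mp (pow_eq_zero_iff two_ne_zero |>.mp this)

end SpecialLinear

/-! ### Cuspidal representations restricted to the unipotent subgroup. -/

section FiniteCuspidal

variable {k V : Type*} [Field k] [AddCommGroup V] [Module ℂ V]
  (σ : Representation ℂ SL(2, k) V)

/-- The `ψ`-eigenspace of the unipotent upper triangular subgroup. -/
def unipotentEigenspace (ψ : AddChar k ℂ) : Submodule ℂ V where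
  carrier := {v | ∀ x, σ (upperUnipotent x) v = ψ x • v}
  add_mem' := by
    intro a b ha hb x
    rw [map_add, ha x, hb x, smul_add]
  zero_mem' := by simp
  smul_mem' := by
    intro c v hv x
    rw [map_smul, hv x, smul_comm]

variable {σ}

theorem unipotentEigenspace_one (hσ : IsCuspidal σ) {v : V}
    (hv : v ∈ unipotentEigenspace σ (1 : AddChar k ℂ)) : v = 0 :=
  hσ.no_fixed v fun x => by rw [hv x, AddChar.one_apply, one_smul]

theorem diagSL_mem {ψ : AddChar k ℂ} {v : V} (hv : v ∈ unipotentEigenspace σ ψ) (t : kˣ) :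
    σ (diagSL t) v ∈ unipotentEigenspace σ (AddChar.mulShift ψ ((↑t⁻¹ : k) ^ 2)) := by
  intro x
  rw [← Module.End.mul_apply, ← map_mul, upperUnipotent_mul_diagSL, map_mul,
    Module.End.mul_apply, hv, map_smul, AddChar.mulShift_apply, mul_comm x]

theorem span_orbit_eq_top (hσ : σ.IsIrreducible) {v : V} (hv : v ≠ 0) :
    Submodule.span ℂ (Set.range fun g => σ g v) = ⊤ := by
  let W : Subrepresentation σ :=
    { toSubmodule := Submodule.span ℂ (Set.range fun g => σ g v)
      apply_mem_toSubmodule := by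
        intro g w hw
        induction hw using Submodule.span_induction with
        | mem x hx =>
          obtain ⟨h, rfl⟩ := hx
          refine Submodule.subset_span ⟨g * h, ?_⟩
          simp
        | zero => simp
        | add x y _ _ hx hy => rw [map_add]; exact Submodule.add_mem _ hx hy
        | smul c x _ hx => rw [map_smul]; exact Submodule.smul_mem _ _ hx }
  have hvW : v ∈ W.toSubmodule := Submodule.subset_span ⟨1, by simp⟩
  have : IsSimpleOrder (Subrepresentation σ) := hσ
  rcases eq_bot_or_eq_top W with h | h
  · rw [h] at hvW
    exact absurd ((Submodule.mem_bot ℂ).mp hvW) hv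
  · exact congrArg Subrepresentation.toSubmodule h

variable [Fintype k]

variable (σ) in
/-- The projection onto the `ψ`-eigenspace of the unipotent upper triangular subgroup. -/
noncomputable def unipotentProj (ψ : AddChar k ℂ) : V →ₗ[ℂ] V :=
  (Fintype.card k : ℂ)⁻¹ • ∑ x, ψ (-x) • σ (upperUnipotent x)

theorem unipotentProj_apply (ψ : AddChar k ℂ) (v : V) :
    unipotentProj σ ψ v =
      (Fintype.card k : ℂ)⁻¹ • ∑ x, ψ (-x) • σ (upperUnipotent x) v := by
  simp [unipotentProj]

theorem unipotentProj_unipotent (ψ : AddChar k ℂ) (y : k) (v : V) :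
    unipotentProj σ ψ (σ (upperUnipotent y) v) = ψ y • unipotentProj σ ψ v := by
  rw [unipotentProj_apply, unipotentProj_apply, smul_comm (ψ y)]
  congr 1
  rw [Finset.smul_sum, ← Equiv.sum_comp (Equiv.subRight y)]
  refine Finset.sum_congr rfl fun x _ => ?_
  rw [← Module.End.mul_apply, ← map_mul, ← upperUnipotent_add, smul_smul,
    ← AddChar.map_add_eq_mul, Equiv.subRight_apply, sub_add_cancel]
  congr 2
  ring

theorem unipotentProj_mem (ψ : AddChar k ℂ) (v : V) :
    unipotentProj σ ψ v ∈ unipotentEigenspace σ ψ := by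
  intro y
  rw [← unipotentProj_unipotent, unipotentProj_apply, unipotentProj_apply, map_smul, map_sum]
  congr 1
  refine Finset.sum_congr rfl fun x _ => ?_
  rw [map_smul, ← Module.End.mul_apply, ← Module.End.mul_apply, ← map_mul, ← map_mul,
    ← upperUnipotent_add, ← upperUnipotent_add, add_comm]

theorem unipotentProj_of_mem {ψ : AddChar k ℂ} {v : V} (hv : v ∈ unipotentEigenspace σ ψ) :
    unipotentProj σ ψ v = v := by
  rw [unipotentProj_apply]
  have : ∀ x, ψ (-x) • σ (upperUnipotent x) v = v := fun x => by
    rw [hv x, smul_smul, apply_neg_mul_self, one_smul]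
  simp only [this, Finset.sum_const, Finset.card_univ]
  rw [← Nat.cast_smul_eq_nsmul ℂ, smul_smul, inv_mul_cancel₀, one_smul]
  exact_mod_cast Fintype.card_ne_zero

theorem unipotentProj_of_mem_of_ne {ψ ψ' : AddChar k ℂ} (h : ψ ≠ ψ') {v : V}
    (hv : v ∈ unipotentEigenspace σ ψ') : unipotentProj σ ψ v = 0 := by
  obtain ⟨x, hx⟩ := DFunLike.ne_iff.mp h
  have h1 := unipotentProj_unipotent (σ := σ) ψ x v
  rw [hv x, map_smul, ← sub_eq_zero, ← sub_smul] at h1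
  exact (smul_eq_zero.mp h1).resolve_left (sub_ne_zero.mpr hx.symm)

theorem sum_unipotentProj (v : V) : ∑ ψ : AddChar k ℂ, unipotentProj σ ψ v = v := by
  classical
  simp only [unipotentProj_apply]
  rw [← Finset.smul_sum, Finset.sum_comm]
  simp only [← Finset.sum_smul, AddChar.sum_apply_eq_ite, neg_eq_zero, ite_smul, zero_smul,
    Finset.sum_ite_eq', Finset.mem_univ, if_true]
  rw [upperUnipotent_zero, map_one, smul_smul, inv_mul_cancel₀, one_smul, Module.End.one_apply]
  exact_mod_cast Fintype.card_ne_zero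

theorem finite_of_isIrreducible (hσ : σ.IsIrreducible) : Module.Finite ℂ V := by
  by_cases h : ∃ v : V, v ≠ 0
  · obtain ⟨v, hv⟩ := h
    refine ⟨⟨(Set.finite_range fun g => σ g v).toFinset, ?_⟩⟩
    rw [Set.Finite.coe_toFinset, span_orbit_eq_top hσ hv]
  · push Not at h
    have : Subsingleton V := ⟨fun a b => by rw [h a, h b]⟩
    infer_instance

/-- Both unipotent factors of the Bruhat decomposition become scalars. The resulting exponent
involves only the trace of `g`, which is what makes the swap of diagonal entries harmless. -/
theorem unipotentProj_bigCell {ψ : AddChar k ℂ} {v : V} (hv : v ∈ unipotentEigenspace σ ψ)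
    (g : SL(2, k)) (c : kˣ) (hc : g 1 0 = c) :
    unipotentProj σ ψ (σ g v) =
      ψ ((g 0 0 + g 1 1) * ↑c⁻¹) • unipotentProj σ ψ (σ (antidiag c) v) := by
  conv_lhs => rw [eq_mul_antidiag_mul g c hc]
  rw [map_mul, map_mul, Module.End.mul_apply, Module.End.mul_apply, unipotentProj_unipotent,
    hv, map_smul, map_smul, smul_smul, ← AddChar.map_add_eq_mul, add_mul]

theorem unipotentProj_unipotent_of_mem {ψ : AddChar k ℂ} {v : V}
    (hv : v ∈ unipotentEigenspace σ ψ) (g : SL(2, k)) (hc : g 1 0 = 0) (ha : g 0 0 = 1) :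
    unipotentProj σ ψ (σ g v) = ψ (g 0 1) • v := by
  have hd := g.det_coe
  rw [Matrix.det_fin_two, hc, ha, mul_zero, sub_zero, one_mul] at hd
  have : g = upperUnipotent (g 0 1) := by
    ext i j
    fin_cases i <;> fin_cases j <;> simp [hc, ha, hd]
  rw [this, unipotentProj_unipotent, unipotentProj_of_mem hv]
  rfl

variable [CharP k 2]

/-- Such a `g` moves the $\psi$-eigenspace to that of $x\mapsto\psi(d^2x)$ with $d\ne 1$ its lower
right entry. In characteristic 2 also $d^2\neq 1$, so this is a different character. -/
theorem unipotentProj_borel {ψ : AddChar k ℂ} (hψ : ψ ≠ 1) {v : V}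
    (hv : v ∈ unipotentEigenspace σ ψ) (g : SL(2, k)) (hc : g 1 0 = 0) (ha : g 0 0 ≠ 1) :
    unipotentProj σ ψ (σ g v) = 0 := by
  have hd := g.det_coe
  rw [Matrix.det_fin_two, hc, mul_zero, sub_zero] at hd
  refine unipotentProj_of_mem_of_ne (ψ' := AddChar.mulShift ψ (g 1 1 ^ 2)) ?_ ?_
  · intro h
    have h1 : g 1 1 ^ 2 = 1 ^ 2 := by
      refine (AddChar.to_mulShift_inj_of_isPrimitive (AddChar.IsPrimitive.of_ne_one hψ)) ?_
      change AddChar.mulShift ψ _ = AddChar.mulShift ψ _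
      rw [← h, one_pow, AddChar.mulShift_one]
    rw [sq_inj_of_charP_two h1, mul_one] at hd
    exact ha hd
  · intro x
    have : upperUnipotent x * g = g * upperUnipotent (g 1 1 ^ 2 * x) := by
      ext i j
      fin_cases i <;> fin_cases j <;>
        simp [Matrix.mul_apply, Fin.sum_univ_two, hc]
      linear_combination (-g 1 1 * x) * hd
    rw [← Module.End.mul_apply, ← map_mul, this, map_mul, Module.End.mul_apply, hv, map_smul,
      AddChar.mulShift_apply]

/-- The operator `e_ψ σ(g) e_ψ` does not change when the diagonal entries of `g` are swapped. -/
theorem unipotentProj_swap {ψ : AddChar k ℂ} (hψ : ψ ≠ 1) {v : V}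
    (hv : v ∈ unipotentEigenspace σ ψ) (g g' : SL(2, k)) (h00 : g' 0 0 = g 1 1)
    (h11 : g' 1 1 = g 0 0) (h01 : g' 0 1 = g 0 1) (h10 : g' 1 0 = g 1 0) :
    unipotentProj σ ψ (σ g v) = unipotentProj σ ψ (σ g' v) := by
  by_cases hc : g 1 0 = 0
  · have hd := g.det_coe
    rw [Matrix.det_fin_two, hc, mul_zero, sub_zero] at hd
    by_cases ha : g 0 0 = 1
    · rw [ha, one_mul] at hd
      rw [unipotentProj_unipotent_of_mem hv g hc ha,
        unipotentProj_unipotent_of_mem hv g' (h10.trans hc) (h00.trans hd), h01]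
    · rw [unipotentProj_borel hψ hv g hc ha, unipotentProj_borel hψ hv g' (h10.trans hc)]
      rw [h00]
      intro h
      rw [h, mul_one] at hd
      exact ha hd
  · rw [unipotentProj_bigCell hv g (Units.mk0 _ hc) rfl,
      unipotentProj_bigCell hv g' (Units.mk0 _ hc) h10, h00, h11, add_comm]

/-- Expanding the inner projector leaves products `antidiag s * upperUnipotent x * antidiag t`, in
which exchanging `s` and `t` exchanges the diagonal entries and nothing else. This is the
commutativity of the Hecke algebra of $(U,\psi)$. -/
theorem unipotentProj_antidiag_comm {ψ : AddChar k ℂ} (hψ : ψ ≠ 1) {v : V}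
    (hv : v ∈ unipotentEigenspace σ ψ) (s t : kˣ) :
    unipotentProj σ ψ (σ (antidiag s) (unipotentProj σ ψ (σ (antidiag t) v))) =
      unipotentProj σ ψ (σ (antidiag t) (unipotentProj σ ψ (σ (antidiag s) v))) := by
  rw [unipotentProj_apply ψ (σ (antidiag t) v), unipotentProj_apply ψ (σ (antidiag s) v)]
  simp only [map_smul, map_sum]
  congr 1
  refine Finset.sum_congr rfl fun x _ => ?_
  congr 1
  simp only [← Module.End.mul_apply, ← map_mul]
  refine unipotentProj_swap hψ hv _ _ ?_ ?_ ?_ ?_ <;>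
    simp [Matrix.mul_apply, Fin.sum_univ_two] <;> ring

theorem unipotentProj_cases {ψ : AddChar k ℂ} (hψ : ψ ≠ 1) (g : SL(2, k)) :
    (∃ (c : kˣ) (r : ℂ), ∀ v ∈ unipotentEigenspace σ ψ,
      unipotentProj σ ψ (σ g v) = r • unipotentProj σ ψ (σ (antidiag c) v)) ∨
    ∃ r : ℂ, ∀ v ∈ unipotentEigenspace σ ψ, unipotentProj σ ψ (σ g v) = r • v := by
  by_cases hc : g 1 0 = 0
  · right
    by_cases ha : g 0 0 = 1
    · exact ⟨_, fun v hv => unipotentProj_unipotent_of_mem hv g hc ha⟩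
    · exact ⟨0, fun v hv => by rw [unipotentProj_borel hψ hv g hc ha, zero_smul]⟩
  · exact Or.inl ⟨Units.mk0 _ hc, _, fun v hv => unipotentProj_bigCell hv g _ rfl⟩

/-- An eigenvector `v` of this operator generates $V$, and the operator commutes with every
$e_\psi\sigma(g)e_\psi$, so its eigenvalue on `v` spreads to the whole $\psi$-eigenspace. -/
theorem exists_antidiag_scalar (hσ : σ.IsIrreducible) {ψ : AddChar k ℂ} (hψ : ψ ≠ 1) (c : kˣ) :
    ∃ μ : ℂ, ∀ v ∈ unipotentEigenspace σ ψ,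
      unipotentProj σ ψ (σ (antidiag c) v) = μ • v := by
  have := finite_of_isIrreducible hσ
  by_cases hne : Nontrivial (unipotentEigenspace σ ψ)
  · let T : Module.End ℂ (unipotentEigenspace σ ψ) :=
      ((unipotentProj σ ψ ∘ₗ σ (antidiag c)) ∘ₗ Submodule.subtype _).codRestrict _
        fun v => unipotentProj_mem ψ _
    obtain ⟨μ, hμ⟩ := Module.End.exists_eigenvalue T
    obtain ⟨⟨v, hv⟩, hTv, hv0⟩ := hμ.exists_hasEigenvector
    have hv0' : v ≠ 0 := fun h => hv0 (Subtype.ext h)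
    have hTv' : unipotentProj σ ψ (σ (antidiag c) v) = μ • v :=
      congrArg Subtype.val (Module.End.mem_eigenspace_iff.mp hTv)
    refine ⟨μ, fun w hw => ?_⟩
    have key : ∀ x : V, unipotentProj σ ψ (σ (antidiag c) (unipotentProj σ ψ x)) =
        μ • unipotentProj σ ψ x := by
      intro x
      have hx : x ∈ Submodule.span ℂ (Set.range fun g => σ g v) := by
        rw [span_orbit_eq_top hσ hv0']; trivial
      induction hx using Submodule.span_induction with
      | mem x hx =>
        obtain ⟨g, rfl⟩ := hx
        rcases unipotentProj_cases (σ := σ) hψ g with ⟨s, r, h⟩ | ⟨r, h⟩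
        · simp only [h v hv, map_smul]
          rw [unipotentProj_antidiag_comm hψ hv, hTv']
          simp only [map_smul]
          rw [smul_comm]
        · simp only [h v hv, map_smul]
          rw [hTv', smul_comm]
      | zero => simp
      | add x y _ _ hx hy => simp only [map_add, hx, hy, smul_add]
      | smul a x _ hx => simp only [map_smul, hx]; rw [smul_comm]
    have := key w
    rwa [unipotentProj_of_mem hw] at this
  · refine ⟨0, fun v hv => ?_⟩
    rw [not_nontrivial_iff_subsingleton] at hne
    have : v = 0 := congrArg Subtype.val (Subsingleton.elim (⟨v, hv⟩ : unipotentEigenspace σ ψ) 0)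
    simp [this]

/-- Multiplicity one for nontrivial characters of the unipotent subgroup. -/
theorem exists_eq_smul_of_mem (hσ : σ.IsIrreducible) {ψ : AddChar k ℂ} (hψ : ψ ≠ 1) {v w : V}
    (hv : v ∈ unipotentEigenspace σ ψ) (hv0 : v ≠ 0) (hw : w ∈ unipotentEigenspace σ ψ) :
    ∃ r : ℂ, w = r • v := by
  -- The orbit of `v` spans $V$, and every $e_\psi\sigma(g)e_\psi$ is now known to be a scalar on
  -- the eigenspace.
  have key : ∀ x : V, ∃ r : ℂ, unipotentProj σ ψ x = r • v := by
    intro x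
    have hx : x ∈ Submodule.span ℂ (Set.range fun g => σ g v) := by
      rw [span_orbit_eq_top hσ hv0]; trivial
    induction hx using Submodule.span_induction with
    | mem x hx =>
      obtain ⟨g, rfl⟩ := hx
      rcases unipotentProj_cases (σ := σ) hψ g with ⟨s, r, h⟩ | ⟨r, h⟩
      · obtain ⟨μ, hμ⟩ := exists_antidiag_scalar hσ hψ s
        exact ⟨r * μ, by simp only [h v hv]; rw [hμ v hv, smul_smul]⟩
      · exact ⟨r, h v hv⟩
    | zero => exact ⟨0, by simp⟩
    | add x y _ _ hx hy =>
      obtain ⟨r, hr⟩ := hx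
      obtain ⟨s, hs⟩ := hy
      exact ⟨r + s, by rw [map_add, hr, hs, add_smul]⟩
    | smul a x _ hx =>
      obtain ⟨r, hr⟩ := hx
      exact ⟨a * r, by rw [map_smul, hr, smul_smul]⟩
  obtain ⟨r, hr⟩ := key w
  exact ⟨r, by rw [← hr, unipotentProj_of_mem hw]⟩

/-- The torus permutes the nontrivial characters of the unipotent subgroup transitively. -/
theorem exists_mulShift_sq {ψ ψ' : AddChar k ℂ} (hψ : ψ ≠ 1) (hψ' : ψ' ≠ 1) :
    ∃ t : kˣ, ψ' = AddChar.mulShift ψ ((↑t⁻¹ : k) ^ 2) := by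
  -- Primitivity of $\psi$ and injectivity of squaring give injectivity; there are as many
  -- characters as elements of `k`.
  have hbij : Function.Bijective fun s : k => AddChar.mulShift ψ (s ^ 2) := by
    rw [Fintype.bijective_iff_injective_and_card]
    refine ⟨fun a b h => ?_, AddChar.card_eq.symm⟩
    exact sq_inj_of_charP_two
      (AddChar.to_mulShift_inj_of_isPrimitive (AddChar.IsPrimitive.of_ne_one hψ) h)
  obtain ⟨s, hs⟩ := hbij.2 ψ'
  simp only at hs
  have hs0 : s ≠ 0 := by
    rintro rfl
    refine hψ' (hs.symm.trans ?_)
    ext x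
    simp
  exact ⟨(Units.mk0 s hs0)⁻¹, by simpa using hs.symm⟩

theorem exists_mem_ne_zero (hσ : IsCuspidal σ) {ψ : AddChar k ℂ} (hψ : ψ ≠ 1) :
    ∃ v ∈ unipotentEigenspace σ ψ, v ≠ 0 := by
  have : IsSimpleOrder (Subrepresentation σ) := hσ.irreducible
  have hV : ∃ v : V, v ≠ 0 := by
    by_contra! h
    refine bot_ne_top (α := Subrepresentation σ) (SetLike.ext fun v => ?_)
    rw [h v]
    exact ⟨fun _ => (⊤ : Subrepresentation σ).toSubmodule.zero_mem,
      fun _ => (⊥ : Subrepresentation σ).toSubmodule.zero_mem⟩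
  obtain ⟨v, hv⟩ := hV
  have : ∃ ψ₀ : AddChar k ℂ, unipotentProj σ ψ₀ v ≠ 0 := by
    by_contra! h
    exact hv (by rw [← sum_unipotentProj (σ := σ) v, Finset.sum_eq_zero fun ψ _ => h ψ])
  obtain ⟨ψ₀, h₀⟩ := this
  have hψ₀ : ψ₀ ≠ 1 := by
    rintro rfl
    exact h₀ (unipotentEigenspace_one hσ (unipotentProj_mem _ _))
  obtain ⟨t, rfl⟩ := exists_mulShift_sq hψ₀ hψ
  refine ⟨_, diagSL_mem (unipotentProj_mem ψ₀ v) t, fun h => h₀ ?_⟩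
  have := congrArg (σ (diagSL t)⁻¹) h
  rwa [← Module.End.mul_apply, ← map_mul, inv_mul_cancel, map_one, map_zero] at this

/-- A cuspidal representation has a basis of eigenvectors of the unipotent subgroup, one for each
nontrivial character. -/
theorem exists_eigenbasis (hσ : IsCuspidal σ) :
    ∃ b : Module.Basis {ψ : AddChar k ℂ // ψ ≠ 1} ℂ V,
      ∀ ψ, b ψ ∈ unipotentEigenspace σ ψ.1 := by
  choose v hv hv0 using fun ψ : {ψ : AddChar k ℂ // ψ ≠ 1} => exists_mem_ne_zero hσ ψ.2
  refine ⟨Module.Basis.mk (v := v) ?_ ?_, fun ψ => by rw [Module.Basis.mk_apply]; exact hv ψ⟩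
  · rw [Fintype.linearIndependent_iff]
    intro c hc ψ
    have h := congrArg (unipotentProj σ ψ.1) hc
    rw [map_sum, map_zero, Finset.sum_eq_single ψ, map_smul, unipotentProj_of_mem (hv ψ)] at h
    · exact (smul_eq_zero.mp h).resolve_right (hv0 ψ)
    · intro φ _ hφ
      rw [map_smul, unipotentProj_of_mem_of_ne (fun h => hφ (Subtype.ext h.symm)) (hv φ),
        smul_zero]
    · simp
  · intro w _
    rw [← sum_unipotentProj (σ := σ) w]
    refine Submodule.sum_mem _ fun ψ _ => ?_
    by_cases hψ : ψ = 1
    · subst hψ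
      rw [unipotentEigenspace_one hσ (unipotentProj_mem _ w)]
      exact Submodule.zero_mem _
    · obtain ⟨r, hr⟩ := exists_eq_smul_of_mem hσ.irreducible hψ (hv ⟨ψ, hψ⟩) (hv0 ⟨ψ, hψ⟩)
        (unipotentProj_mem ψ w)
      rw [hr]
      exact Submodule.smul_mem _ _ (Submodule.subset_span ⟨_, rfl⟩)

end FiniteCuspidal

/-! ### Dimensions of commutants over a finite field, and the Artin-Schreier index. -/

section RelativeCommutant

variable {k V : Type*} [Field k] [AddCommGroup V] [Module ℂ V]
  (σ : Representation ℂ SL(2, k) V)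

/-- The linear maps intertwining `u ↦ σ(u)` and `u ↦ σ(u u_z)` on the unipotent subgroup, for
all `z ∈ Z`. -/
def relativeCommutant (Z : Set k) : Submodule ℂ (V →ₗ[ℂ] V) where
  carrier := {f | (∀ x v, f (σ (upperUnipotent x) v) = σ (upperUnipotent x) (f v)) ∧
    ∀ z ∈ Z, ∀ v, σ (upperUnipotent z) (f v) = f v}
  add_mem' := by
    rintro f g ⟨hf, hf'⟩ ⟨hg, hg'⟩
    exact ⟨fun x v => by simp [hf, hg], fun z hz v => by simp [hf' z hz, hg' z hz]⟩
  zero_mem' := by simp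
  smul_mem' := by
    rintro c f ⟨hf, hf'⟩
    exact ⟨fun x v => by simp [hf], fun z hz v => by simp [hf' z hz]⟩

/-- The linear maps commuting with the upper triangular subgroup. -/
def borelCommutant : Submodule ℂ (V →ₗ[ℂ] V) where
  carrier := {f | ∀ g : SL(2, k), g 1 0 = 0 → ∀ v, f (σ g v) = σ g (f v)}
  add_mem' := by
    intro f f' hf hf' g hg v
    simp [hf g hg, hf' g hg]
  zero_mem' := by simp
  smul_mem' := by
    intro c f hf g hg v
    simp [hf g hg]

variable {σ}

theorem apply_mem_unipotentEigenspace {f : V →ₗ[ℂ] V}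
    (hf : ∀ x v, f (σ (upperUnipotent x) v) = σ (upperUnipotent x) (f v)) {ψ : AddChar k ℂ} {v : V}
    (hv : v ∈ unipotentEigenspace σ ψ) : f v ∈ unipotentEigenspace σ ψ := by
  intro x
  rw [← hf, hv, map_smul]

variable [Finite k] [CharP k 2]

/-- A linear map that is invariant under the unipotent subgroup vanishes. -/
theorem eq_zero_of_forall_apply_unipotent (hσ : IsCuspidal σ) {f : V →ₗ[ℂ] V}
    (hf : ∀ x v, f (σ (upperUnipotent x) v) = f v) : f = 0 := by
  have := Fintype.ofFinite k
  obtain ⟨b, hb⟩ := exists_eigenbasis hσ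
  refine b.ext fun ψ => ?_
  obtain ⟨x, hx⟩ := DFunLike.ne_iff.mp ψ.2
  have h := hf x (b ψ)
  rw [hb ψ x, map_smul, ← sub_eq_zero] at h
  nth_rewrite 2 [← one_smul ℂ (f (b ψ))] at h
  rw [← sub_smul] at h
  exact (smul_eq_zero.mp h).resolve_left (sub_ne_zero.mpr hx)

omit [CharP k 2] in
theorem card_nontrivial_addChar_quotient (Z : AddSubgroup k) :
    Nat.card {ψ : {ψ : AddChar k ℂ // ψ ≠ 1} // ∀ z ∈ Z, ψ.1 z = 1} =
      Nat.card (k ⧸ Z) - 1 := by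
  classical
  have := Fintype.ofFinite (k ⧸ Z)
  let φ : {χ : AddChar (k ⧸ Z) ℂ // χ ≠ 1} →
      {ψ : {ψ : AddChar k ℂ // ψ ≠ 1} // ∀ z ∈ Z, ψ.1 z = 1} := fun χ =>
    ⟨⟨χ.1.compAddMonoidHom (QuotientAddGroup.mk' Z), by
      intro h
      refine χ.2 (DFunLike.ext _ _ fun x => ?_)
      obtain ⟨x, rfl⟩ := QuotientAddGroup.mk_surjective x
      exact DFunLike.congr_fun h x⟩, by
      intro z hz
      have : (QuotientAddGroup.mk' Z) z = 0 := (QuotientAddGroup.eq_zero_iff z).mpr hz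
      simp [this]⟩
  have hφ : Function.Bijective φ := by
    constructor
    · intro χ χ' h
      refine Subtype.ext (DFunLike.ext _ _ fun x => ?_)
      obtain ⟨x, rfl⟩ := QuotientAddGroup.mk_surjective x
      have := congrArg (fun ψ => ψ.1.1 x) h
      exact this
    · rintro ⟨⟨ψ, hψ⟩, hZ⟩
      let χ : AddChar (k ⧸ Z) ℂ := AddChar.toAddMonoidHomEquiv.symm
        (QuotientAddGroup.lift Z (AddChar.toAddMonoidHomEquiv ψ) fun z hz => by
          simpa using hZ z hz)
      have hχ : ∀ x : k, χ (x : k ⧸ Z) = ψ x := fun x => rfl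
      refine ⟨⟨χ, ?_⟩, ?_⟩
      · rintro h
        refine hψ (DFunLike.ext _ _ fun x => ?_)
        rw [← hχ, h]
        simp
      · exact Subtype.ext (Subtype.ext (DFunLike.ext _ _ fun x => hχ x))
  rw [← Nat.card_congr (Equiv.ofBijective φ hφ), Nat.card_eq_fintype_card, Nat.card_eq_fintype_card,
    Fintype.card_subtype_compl, Fintype.card_subtype_eq, AddChar.card_eq]

/-- By multiplicity one such a map is diagonal in the eigenbasis. Invariance of its image under $Z$
kills the coefficient at every $\psi$ nontrivial on $Z$; the other coefficients are free. -/
theorem rank_relativeCommutant (hσ : IsCuspidal σ) (Z : AddSubgroup k) :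
    Module.rank ℂ (relativeCommutant σ (Z : Set k)) = (Nat.card (k ⧸ Z) - 1 : ℕ) := by
  classical
  have := Fintype.ofFinite k
  have := finite_of_isIrreducible hσ.irreducible
  obtain ⟨b, hb⟩ := exists_eigenbasis hσ
  have hscalar : ∀ f ∈ relativeCommutant σ (Z : Set k), ∀ ψ,
      f (b ψ) = (b.repr (f (b ψ)) ψ) • b ψ := by
    intro f hf ψ
    obtain ⟨r, hr⟩ := exists_eq_smul_of_mem hσ.irreducible ψ.2 (hb ψ) (b.ne_zero ψ)
      (apply_mem_unipotentEigenspace hf.1 (hb ψ))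
    rw [hr]
    simp
  let G : relativeCommutant σ (Z : Set k) →ₗ[ℂ]
      ({ψ : {ψ : AddChar k ℂ // ψ ≠ 1} // ∀ z ∈ Z, ψ.1 z = 1} → ℂ) :=
    { toFun := fun f ψ => b.repr (f.1 (b ψ.1)) ψ.1
      map_add' := fun f g => by ext; simp
      map_smul' := fun c f => by ext; simp }
  have hG : Function.Bijective G := by
    constructor
    · rw [injective_iff_map_eq_zero]
      rintro ⟨f, hf⟩ h
      refine Subtype.ext (b.ext fun ψ => ?_)
      by_cases hψ : ∀ z ∈ Z, ψ.1 z = 1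
      · have h1 : b.repr (f (b ψ)) ψ = 0 := congrFun h ⟨ψ, hψ⟩
        rw [hscalar f hf ψ, h1, zero_smul]
        rfl
      · push Not at hψ
        obtain ⟨z, hz, hz1⟩ := hψ
        have h1 := hf.2 z hz (b ψ)
        rw [apply_mem_unipotentEigenspace hf.1 (hb ψ) z, ← sub_eq_zero] at h1
        nth_rewrite 2 [← one_smul ℂ (f (b ψ))] at h1
        rw [← sub_smul] at h1
        exact (smul_eq_zero.mp h1).resolve_left (sub_ne_zero.mpr hz1)
    · intro c
      let f : V →ₗ[ℂ] V := b.constr ℂ fun ψ =>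
        if h : ∀ z ∈ Z, ψ.1 z = 1 then c ⟨ψ, h⟩ • b ψ else 0
      have hf : ∀ ψ, f (b ψ) = if h : ∀ z ∈ Z, ψ.1 z = 1 then c ⟨ψ, h⟩ • b ψ else 0 :=
        fun ψ => b.constr_basis ℂ _ ψ
      refine ⟨⟨f, ?_, ?_⟩, ?_⟩
      · intro x v
        refine LinearMap.congr_fun (f := f ∘ₗ σ (upperUnipotent x))
          (g := σ (upperUnipotent x) ∘ₗ f) (b.ext fun ψ => ?_) v
        rw [LinearMap.comp_apply, LinearMap.comp_apply, hb ψ x, map_smul, hf]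
        split_ifs
        · rw [map_smul, hb ψ x, smul_comm]
        · simp
      · intro z hz v
        refine LinearMap.congr_fun (f := σ (upperUnipotent z) ∘ₗ f) (g := f)
          (b.ext fun ψ => ?_) v
        rw [LinearMap.comp_apply, hf]
        split_ifs with h
        · rw [map_smul, hb ψ z, h z hz, one_smul]
        · simp
      · ext ψ
        change b.repr (f (b ψ.1)) ψ.1 = c ψ
        rw [hf, dif_pos ψ.2]
        simp
  rw [← Module.finrank_eq_rank, (LinearEquiv.ofBijective G hG).finrank_eq,
    Module.finrank_fintype_fun_eq_card, ← Nat.card_eq_fintype_card,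
    card_nontrivial_addChar_quotient]

theorem rank_borelCommutant (hσ : IsCuspidal σ) : Module.rank ℂ (borelCommutant σ) = 1 := by
  have := Fintype.ofFinite k
  have := finite_of_isIrreducible hσ.irreducible
  obtain ⟨b, hb⟩ := exists_eigenbasis hσ
  have : Nontrivial (AddChar k ℂ) := by
    rw [← Fintype.one_lt_card_iff_nontrivial, AddChar.card_eq]
    exact Fintype.one_lt_card
  obtain ⟨ψ₀, hψ₀⟩ := exists_ne (1 : AddChar k ℂ)
  have hV : (LinearMap.id : V →ₗ[ℂ] V) ≠ 0 := fun h =>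
    b.ne_zero ⟨ψ₀, hψ₀⟩ (LinearMap.congr_fun h _)
  have : borelCommutant σ = Submodule.span ℂ {LinearMap.id} := by
    refine le_antisymm (fun f hf => ?_) ?_
    · have hU : ∀ x v, f (σ (upperUnipotent x) v) = σ (upperUnipotent x) (f v) :=
        fun x => hf _ (by simp)
      obtain ⟨r, hr⟩ := exists_eq_smul_of_mem hσ.irreducible hψ₀ (hb ⟨ψ₀, hψ₀⟩)
        (b.ne_zero _) (apply_mem_unipotentEigenspace hU (hb ⟨ψ₀, hψ₀⟩))
      rw [Submodule.mem_span_singleton]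
      refine ⟨r, b.ext fun ψ => ?_⟩
      -- The torus carries the scalar `r` found at $\psi_0$ to every other eigenline.
      obtain ⟨t, ht⟩ := exists_mulShift_sq hψ₀ ψ.2
      have hmem := diagSL_mem (hb ⟨ψ₀, hψ₀⟩) t
      rw [← ht] at hmem
      obtain ⟨s, hs⟩ := exists_eq_smul_of_mem hσ.irreducible ψ.2 hmem (by
        intro h
        have := congrArg (σ (diagSL t)⁻¹) h
        rw [← Module.End.mul_apply, ← map_mul, inv_mul_cancel, map_one, map_zero] at this
        exact b.ne_zero _ this) (hb ψ)
      rw [hs, map_smul, map_smul, hf (diagSL t) (by simp), hr, map_smul]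
      rfl
    · rw [Submodule.span_singleton_le_iff_mem]
      intro g _ v
      rfl
  rw [← Module.finrank_eq_rank, this, finrank_span_singleton hV, Nat.cast_one]

/-- The Artin-Schreier type map `r ↦ a (r² + u r)` in characteristic two. -/
def artinSchreier (a u : k) : k →+ k where
  toFun r := a * (r ^ 2 + u * r)
  map_zero' := by simp
  map_add' x y := by
    rw [add_pow_char]
    ring

omit [Finite k] in
theorem artinSchreier_apply (a u r : k) : artinSchreier a u r = a * (r ^ 2 + u * r) := rfl

/-- For an endomorphism of a finite group, the index of the image is the order of the kernel, here
$\{0,u\}$. -/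
theorem card_quotient_artinSchreier {a u : k} (ha : a ≠ 0) (hu : u ≠ 0) :
    Nat.card (k ⧸ (artinSchreier a u).range) = 2 := by
  have hker : Nat.card (artinSchreier a u).ker = 2 := by
    have : ((artinSchreier a u).ker : Set k) = {0, u} := by
      ext r
      rw [SetLike.mem_coe, AddMonoidHom.mem_ker, artinSchreier_apply, mul_eq_zero,
        or_iff_right ha]
      have : r ^ 2 + u * r = r * (r - u) := by
        rw [CharTwo.sub_eq_add]; ring
      rw [this, mul_eq_zero, sub_eq_zero]
      rfl
    rw [← SetLike.coe_sort_coe, this, Nat.card_coe_set_eq, Set.ncard_pair hu.symm]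
  have h1 := AddSubgroup.card_mul_index (artinSchreier a u).ker
  have h2 := AddSubgroup.card_mul_index (artinSchreier a u).range
  rw [AddSubgroup.index_ker, hker] at h1
  rw [AddSubgroup.index, ← h1, mul_comm 2] at h2
  exact Nat.eq_of_mul_eq_mul_left Nat.card_pos h2

theorem artinSchreier_zero_surjective {a : k} (ha : a ≠ 0) :
    Function.Surjective (artinSchreier a 0) := by
  rw [← Finite.injective_iff_surjective]
  intro x y h
  simp only [artinSchreier_apply, zero_mul, add_zero] at h
  exact sq_inj_of_charP_two (mul_left_cancel₀ ha h)

end RelativeCommutant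

/-! ### From subgroups of GL(2, F) to matrix conditions over the ring of integers. -/

theorem rank_intertwiningMap_eq {G V : Type*} [Group G] [AddCommGroup V] [Module ℂ V]
    (ρ₁ ρ₂ : Representation ℂ G V) (S : Submodule ℂ (V →ₗ[ℂ] V))
    (hS : ∀ f, f ∈ S ↔ ∀ g v, f (ρ₁ g v) = ρ₂ g (f v)) :
    Module.rank ℂ (Representation.IntertwiningMap ρ₁ ρ₂) = Module.rank ℂ S :=
  LinearEquiv.rank_eq
    { toFun := fun f => ⟨f.toLinearMap, (hS _).mpr f.isIntertwining⟩
      map_add' := fun _ _ => rfl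
      map_smul' := fun _ _ => rfl
      invFun := fun f => f.1.intertwiningMap_of_isIntertwiningMap ρ₁ ρ₂ ((hS _).mp f.2)
      left_inv := fun _ => rfl
      right_inv := fun _ => rfl }

section LocalField

variable {F : Type*} [Field F] [ValuativeRel F]

/-- `p` is the conjugate `g_ℓ⁻¹ h g_ℓ` of `h`. -/
structure IsDiagConj (ϖ : 𝒪[F]) (ℓ : ℕ) (h p : SL(2, 𝒪[F])) : Prop where
  zero_zero : h 0 0 = p 0 0
  one_one : h 1 1 = p 1 1
  zero_one : h 0 1 = ϖ ^ ℓ * p 0 1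
  one_zero : p 1 0 = ϖ ^ ℓ * h 1 0

/-- The linear maps intertwining the representation `^{g_ℓ}σ` of the lower triangular subgroup
modulo `𝓟^ℓ` with its conjugate under `a`. -/
def conjIntertwiners {V : Type*} [AddCommGroup V] [Module ℂ V]
    (σ : Representation ℂ SL(2, 𝓀[F]) V) (ϖ : 𝒪[F]) (ℓ : ℕ) (a : SL(2, 𝒪[F])) :
    Submodule ℂ (V →ₗ[ℂ] V) where
  carrier := {f | ∀ h h' p p', IsDiagConj ϖ ℓ h p → IsDiagConj ϖ ℓ h' p' → h * a = a * h' →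
    ∀ v, f (σ (Matrix.SpecialLinearGroup.map (IsLocalRing.residue 𝒪[F]) p) v) =
      σ (Matrix.SpecialLinearGroup.map (IsLocalRing.residue 𝒪[F]) p') (f v)}
  add_mem' := by
    intro f g hf hg h h' p p' hp hp' ha v
    simp [hf h h' p p' hp hp' ha, hg h h' p p' hp hp' ha]
  zero_mem' := by simp
  smul_mem' := by
    intro c f hf h h' p p' hp hp' ha v
    simp [hf h h' p p' hp hp' ha]

theorem IsDiagConj.gEll_mul {ϖ : 𝒪[F]} (hϖ : Irreducible ϖ) {ℓ : ℕ} {h p : SL(2, 𝒪[F])}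
    (hp : IsDiagConj ϖ ℓ h p) :
    Matrix.SpecialLinearGroup.mapGL F h * gEll hϖ ℓ =
      gEll hϖ ℓ * Matrix.SpecialLinearGroup.mapGL F p := by
  have h01 : algebraMap 𝒪[F] F (h 0 1) = (ϖ : F) ^ ℓ * algebraMap 𝒪[F] F (p 0 1) := by
    rw [hp.zero_one, map_mul, map_pow]; rfl
  have h10 : algebraMap 𝒪[F] F (p 1 0) = (ϖ : F) ^ ℓ * algebraMap 𝒪[F] F (h 1 0) := by
    rw [hp.one_zero, map_mul, map_pow]; rfl
  have h00 := hp.zero_zero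
  have h11 := hp.one_one
  ext i j
  fin_cases i <;> fin_cases j <;>
    simp [gEll, Matrix.mul_apply, Fin.sum_univ_two, h01, h10, h00, h11,
      Matrix.SpecialLinearGroup.mapGL_coe_matrix,
      Matrix.GeneralLinearGroup.mkOfDetNeZero, mul_comm]

variable [TopologicalSpace F] [IsNonarchimedeanLocalField F]

theorem IsDiagConj.mem_lowerModO {ϖ : 𝒪[F]} (hϖ : Irreducible ϖ) {ℓ : ℕ} {h p : SL(2, 𝒪[F])}
    (hp : IsDiagConj ϖ ℓ h p) : h ∈ lowerModO (F := F) ℓ := by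
  change h 0 1 ∈ (𝓂[F] ^ ℓ : Ideal 𝒪[F])
  rw [hϖ.maximalIdeal_eq, Ideal.span_singleton_pow, Ideal.mem_span_singleton]
  exact ⟨_, hp.zero_one⟩

theorem exists_isDiagConj {ϖ : 𝒪[F]} (hϖ : Irreducible ϖ) {ℓ : ℕ} {h : SL(2, 𝒪[F])}
    (hh : h ∈ lowerModO (F := F) ℓ) : ∃ p, IsDiagConj ϖ ℓ h p := by
  have ha' : h 0 1 ∈ (𝓂[F] ^ ℓ : Ideal 𝒪[F]) := hh
  rw [hϖ.maximalIdeal_eq, Ideal.span_singleton_pow, Ideal.mem_span_singleton] at ha'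
  obtain ⟨c, hc⟩ := ha'
  have hdet := h.det_coe
  rw [Matrix.det_fin_two, hc] at hdet
  have hb : (!![h 0 0, c; ϖ ^ ℓ * h 1 0, h 1 1]).det = 1 := by
    rw [Matrix.det_fin_two_of]
    linear_combination hdet
  exact ⟨⟨_, hb⟩, rfl, rfl, hc, rfl⟩

variable {V : Type*} [AddCommGroup V] [Module ℂ V] (σ : Representation ℂ SL(2, 𝓀[F]) V)

theorem inflation_of_eq {p : SL(2, 𝒪[F])} (y : maxCompact F)
    (hy : (y : GL (Fin 2) F) = Matrix.SpecialLinearGroup.mapGL F p) :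
    inflation σ y = σ (Matrix.SpecialLinearGroup.map (IsLocalRing.residue 𝒪[F]) p) := by
  obtain ⟨y, hmem⟩ := y
  subst hy
  exact congrArg σ (reduction_mapGL p)

theorem IsDiagConj.twisted_eq {ϖ : 𝒪[F]} (hϖ : Irreducible ϖ) {ℓ : ℕ} {h p : SL(2, 𝒪[F])}
    (hp : IsDiagConj ϖ ℓ h p) (x : lowerMod F ℓ)
    (hx : (x : GL (Fin 2) F) = Matrix.SpecialLinearGroup.mapGL F h) :
    twisted σ hϖ ℓ x = σ (Matrix.SpecialLinearGroup.map (IsLocalRing.residue 𝒪[F]) p) := by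
  have hconj : (gEll hϖ ℓ)⁻¹ * (x : GL (Fin 2) F) * gEll hϖ ℓ =
      Matrix.SpecialLinearGroup.mapGL F p := by
    rw [hx, mul_assoc, hp.gEll_mul hϖ, inv_mul_cancel_left]
  have hmem : (gEll hϖ ℓ)⁻¹ * (x : GL (Fin 2) F) * gEll hϖ ℓ ∈ maxCompact F := by
    rw [hconj]; exact MonoidHom.mem_range.mpr ⟨p, rfl⟩
  exact (conjRep_apply (gEll hϖ ℓ) (inflation σ) (Subgroup.inclusion (lowerMod_le hϖ ℓ) x)
    hmem).trans (inflation_of_eq σ _ hconj)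

theorem twisted_conjRep_eq {ϖ : 𝒪[F]} (hϖ : Irreducible ϖ) {ℓ : ℕ} {h p : SL(2, 𝒪[F])}
    (hp : IsDiagConj ϖ ℓ h p) (g : GL (Fin 2) F)
    (x : (MulAut.conj g • lowerMod F ℓ : Subgroup (GL (Fin 2) F)))
    (hx : g⁻¹ * (x : GL (Fin 2) F) * g = Matrix.SpecialLinearGroup.mapGL F h) :
    conjRep g (twisted σ hϖ ℓ) x =
      σ (Matrix.SpecialLinearGroup.map (IsLocalRing.residue 𝒪[F]) p) := by
  have hm : g⁻¹ * (x : GL (Fin 2) F) * g ∈ lowerMod F ℓ := by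
    rw [hx]
    exact Subgroup.mem_map_of_mem _ (hp.mem_lowerModO hϖ)
  exact (conjRep_apply g (twisted σ hϖ ℓ) x hm).trans (hp.twisted_eq σ hϖ _ hx)

/-- Membership in the intersection of `B'_ℓ` with its conjugate under `a`. -/
theorem mem_conj_inf_lowerMod {ℓ : ℕ} {a : SL(2, 𝒪[F])} {x : GL (Fin 2) F} :
    x ∈ (MulAut.conj (Matrix.SpecialLinearGroup.mapGL F a) • lowerMod F ℓ) ⊓ lowerMod F ℓ ↔
      ∃ h ∈ lowerModO (F := F) ℓ, ∃ h' ∈ lowerModO (F := F) ℓ, h * a = a * h' ∧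
        x = Matrix.SpecialLinearGroup.mapGL F h := by
  rw [Subgroup.mem_inf, Subgroup.mem_smul_pointwise_iff_exists]
  constructor
  · rintro ⟨⟨_, ⟨h', hh', rfl⟩, hx⟩, ⟨h, hh, rfl⟩⟩
    refine ⟨h, hh, h', hh', mapGL_injective (F := F) ?_, rfl⟩
    rw [MulAut.smul_def, MulAut.conj_apply] at hx
    rw [map_mul, map_mul]
    exact (mul_inv_eq_iff_eq_mul.mp hx).symm
  · rintro ⟨h, hh, h', hh', ha, rfl⟩
    refine ⟨⟨_, Subgroup.mem_map_of_mem _ hh', ?_⟩, Subgroup.mem_map_of_mem _ hh⟩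
    rw [MulAut.smul_def, MulAut.conj_apply, mul_inv_eq_iff_eq_mul, ← map_mul, ← map_mul, ha]

/-- An element of the intersection is an `h` in the group with $h'=a^{-1}ha$ in it too. The two
representations send it to $\sigma$ of the reductions of `p` and `p'`, the conjugates of `h` and
`h'` by $g_\ell^{-1}$. -/
theorem rank_selfIntertwiners_mapGL {ϖ : 𝒪[F]} (hϖ : Irreducible ϖ) (ℓ : ℕ) (a : SL(2, 𝒪[F])) :
    Module.rank ℂ (selfIntertwiners (Matrix.SpecialLinearGroup.mapGL F a) (twisted σ hϖ ℓ)) =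
      Module.rank ℂ (conjIntertwiners σ ϖ ℓ a) := by
  have key : ∀ h h' p p', IsDiagConj ϖ ℓ h p → IsDiagConj ϖ ℓ h' p' → h * a = a * h' →
      ∀ x : ((MulAut.conj (Matrix.SpecialLinearGroup.mapGL F a) • lowerMod F ℓ) ⊓ lowerMod F ℓ :
        Subgroup (GL (Fin 2) F)), (x : GL (Fin 2) F) = Matrix.SpecialLinearGroup.mapGL F h →
      resRep inf_le_right (twisted σ hϖ ℓ) x =
        σ (Matrix.SpecialLinearGroup.map (IsLocalRing.residue 𝒪[F]) p) ∧
      resRep inf_le_left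
        (conjRep (Matrix.SpecialLinearGroup.mapGL F a) (twisted σ hϖ ℓ)) x =
        σ (Matrix.SpecialLinearGroup.map (IsLocalRing.residue 𝒪[F]) p') := by
    intro h h' p p' hp hp' ha x hx
    refine ⟨hp.twisted_eq σ hϖ (Subgroup.inclusion inf_le_right x) hx,
      twisted_conjRep_eq σ hϖ hp' _ (Subgroup.inclusion inf_le_left x) ?_⟩
    rw [Subgroup.coe_inclusion, hx, mul_assoc, ← map_mul, ha, map_mul, inv_mul_cancel_left]
  refine rank_intertwiningMap_eq _ _ _ fun f =>
    ⟨fun hf x v => ?_, fun hf h h' p p' hp hp' ha v => ?_⟩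
  · obtain ⟨h, hh, h', hh', ha, hx⟩ := mem_conj_inf_lowerMod.mp x.2
    obtain ⟨p, hp⟩ := exists_isDiagConj hϖ hh
    obtain ⟨p', hp'⟩ := exists_isDiagConj hϖ hh'
    obtain ⟨h1, h2⟩ := key h h' p p' hp hp' ha x hx
    rw [h1, h2]
    exact hf h h' p p' hp hp' ha v
  · have hx := mem_conj_inf_lowerMod.mpr
      ⟨h, hp.mem_lowerModO hϖ, h', hp'.mem_lowerModO hϖ, ha, rfl⟩
    obtain ⟨h1, h2⟩ := key h h' p p' hp hp' ha ⟨_, hx⟩ rfl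
    rw [← h1, ← h2]
    exact hf _ v

end LocalField

section OfEntries

variable {R : Type*} [CommRing R]

/-- The element of `SL(2, R)` with the given entries. -/
def slOfEntries (a b c d : R) (h : a * d - b * c = 1) : SL(2, R) :=
  ⟨!![a, b; c, d], by rw [Matrix.det_fin_two_of, h]⟩

@[simp]
theorem coe_slOfEntries (a b c d : R) (h : a * d - b * c = 1) :
    (slOfEntries a b c d h : Matrix (Fin 2) (Fin 2) R) = !![a, b; c, d] := rfl

end OfEntries

/-! ### Intertwiners for each type of double coset. -/

section Intertwiners

variable {F : Type*} [Field F] [ValuativeRel F]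

theorem isDiagConj_upperUnipotent (ϖ : 𝒪[F]) (ℓ : ℕ) (x : 𝒪[F]) :
    IsDiagConj ϖ ℓ (upperUnipotent (ϖ ^ ℓ * x)) (upperUnipotent x) :=
  ⟨rfl, rfl, rfl, by simp⟩

theorem map_residue_upperUnipotent (x : 𝒪[F]) :
    Matrix.SpecialLinearGroup.map (IsLocalRing.residue 𝒪[F]) (upperUnipotent x) =
      upperUnipotent (IsLocalRing.residue 𝒪[F] x) := by
  ext i j
  fin_cases i <;> fin_cases j <;> simp

theorem map_residue_eq_upperUnipotent {p : SL(2, 𝒪[F])} {z : 𝓀[F]}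
    (h00 : IsLocalRing.residue 𝒪[F] (p 0 0) = 1) (h01 : IsLocalRing.residue 𝒪[F] (p 0 1) = z)
    (h10 : IsLocalRing.residue 𝒪[F] (p 1 0) = 0) (h11 : IsLocalRing.residue 𝒪[F] (p 1 1) = 1) :
    Matrix.SpecialLinearGroup.map (IsLocalRing.residue 𝒪[F]) p = upperUnipotent z := by
  ext i j
  fin_cases i <;> fin_cases j <;> simp [h00, h01, h10, h11]

theorem residue_two [CharP 𝓀[F] 2] : IsLocalRing.residue 𝒪[F] 2 = 0 := by
  rw [map_ofNat]
  exact CharTwo.two_eq_zero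

/-- In characteristic 2 the only square root of 1 is 1. This removes the torus from the analysis of
$g(k,\alpha)$. -/
theorem residue_eq_one_of_mul_eq_one [CharP 𝓀[F] 2] {a d : 𝒪[F]}
    (h : IsLocalRing.residue 𝒪[F] a * IsLocalRing.residue 𝒪[F] d = 1)
    (had : IsLocalRing.residue 𝒪[F] a = IsLocalRing.residue 𝒪[F] d) :
    IsLocalRing.residue 𝒪[F] a = 1 ∧ IsLocalRing.residue 𝒪[F] d = 1 := by
  rw [← had] at h ⊢
  have : IsLocalRing.residue 𝒪[F] a = 1 := sq_inj_of_charP_two (by rw [sq, h, one_pow])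
  exact ⟨this, this⟩

theorem card_quotient_top_sub_one : Nat.card (𝓀[F] ⧸ (⊤ : AddSubgroup 𝓀[F])) - 1 = 0 := by
  rw [← AddSubgroup.index, AddSubgroup.index_top]

variable [TopologicalSpace F] [IsNonarchimedeanLocalField F]
  {ϖ : 𝒪[F]}

theorem residue_eq_zero_iff_dvd (hϖ : Irreducible ϖ) {x : 𝒪[F]} :
    IsLocalRing.residue 𝒪[F] x = 0 ↔ ϖ ∣ x := by
  rw [IsLocalRing.residue_eq_zero_iff, hϖ.maximalIdeal_eq, Ideal.mem_span_singleton]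

theorem residue_pow_mul (hϖ : Irreducible ϖ) {n : ℕ} (hn : n ≠ 0) (x : 𝒪[F]) :
    IsLocalRing.residue 𝒪[F] (ϖ ^ n * x) = 0 :=
  (residue_eq_zero_iff_dvd hϖ).mpr (Dvd.dvd.mul_right (dvd_pow_self _ hn) _)

/-- If $s=\varpi^i r$ with $i<N$, dividing the equation by $\varpi^{2i}$ and reducing leaves
$r^2=0$, because both 2 and the right side retain a factor $\varpi$. So one more factor splits off.
-/
theorem pow_dvd_of_mul_add_two [CharP 𝓀[F] 2] (hϖ : Irreducible ϖ) {N m : ℕ} (hm : 2 * N ≤ m + 1)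
    {s t w : 𝒪[F]} (hw : 2 = ϖ ^ N * w) (h : s * (s + 2) = ϖ ^ m * t) : ϖ ^ N ∣ s := by
  suffices ∀ i ≤ N, ϖ ^ i ∣ s from this N le_rfl
  intro i
  induction i with
  | zero => simp
  | succ i ih =>
    intro hi
    obtain ⟨r, rfl⟩ := ih (by omega)
    obtain ⟨n, rfl⟩ : ∃ n, N = i + (n + 1) := ⟨N - i - 1, by omega⟩
    obtain ⟨l, rfl⟩ : ∃ l, m = i + i + (l + 1) := ⟨m - i - i - 1, by omega⟩
    have h1 : r * (r + ϖ ^ (n + 1) * w) = ϖ ^ (l + 1) * t := by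
      refine mul_left_cancel₀ (pow_ne_zero (i + i) hϖ.ne_zero) ?_
      rw [hw] at h
      simp only [pow_add] at h ⊢
      linear_combination h
    have h2 := congrArg (IsLocalRing.residue 𝒪[F]) h1
    rw [residue_pow_mul hϖ (by omega), map_mul, map_add, residue_pow_mul hϖ (by omega),
      add_zero, mul_self_eq_zero, residue_eq_zero_iff_dvd hϖ] at h2
    rw [pow_succ]
    exact mul_dvd_mul_left _ h2

variable {V : Type*} [AddCommGroup V] [Module ℂ V] {σ : Representation ℂ SL(2, 𝓀[F]) V}

/-- Here $h=h'$, hence $p=p'$. As $\ell\ne 0$, the reductions of such `p` are exactly the upper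
triangular matrices. -/
theorem conjIntertwiners_one (σ : Representation ℂ SL(2, 𝓀[F]) V) (hϖ : Irreducible ϖ) {ℓ : ℕ}
    (hℓ : ℓ ≠ 0) : conjIntertwiners σ ϖ ℓ 1 = borelCommutant σ := by
  refine le_antisymm (fun f hf g hg v => ?_) fun f hf h h' p p' hp hp' ha v => ?_
  · have hd := g.det_coe
    rw [Matrix.det_fin_two, hg, mul_zero, sub_zero] at hd
    obtain ⟨a, ha⟩ := IsLocalRing.residue_surjective (g 0 0)
    obtain ⟨b, hb⟩ := IsLocalRing.residue_surjective (g 0 1)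
    have hu : IsUnit a := by
      by_contra h
      rw [← IsLocalRing.residue_ne_zero_iff_isUnit, not_not] at h
      rw [← ha, h, zero_mul] at hd
      exact zero_ne_one hd
    obtain ⟨d, had⟩ := hu.exists_right_inv
    have hd' : IsLocalRing.residue 𝒪[F] d = g 1 1 := by
      have h1 := congrArg (IsLocalRing.residue 𝒪[F]) had
      rw [map_mul, map_one, ha] at h1
      exact mul_left_cancel₀ (left_ne_zero_of_mul_eq_one hd) (h1.trans hd.symm)
    let p : SL(2, 𝒪[F]) := slOfEntries a b 0 d (by rw [had]; ring)
    let h : SL(2, 𝒪[F]) := slOfEntries a (ϖ ^ ℓ * b) 0 d (by rw [had]; ring)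
    have hp : IsDiagConj ϖ ℓ h p := ⟨rfl, rfl, rfl, by simp [p, h]⟩
    have hpg : Matrix.SpecialLinearGroup.map (IsLocalRing.residue 𝒪[F]) p = g := by
      ext i j
      fin_cases i <;> fin_cases j <;> simp [p, ha, hb, hd', hg]
    have := hf h h p p hp hp (by rw [mul_one, one_mul]) v
    rwa [hpg] at this
  · rw [mul_one, one_mul] at ha
    subst ha
    have : p = p' := by
      ext i j
      fin_cases i <;> fin_cases j
      · exact congrArg Subtype.val (hp.zero_zero.symm.trans hp'.zero_zero)
      · exact congrArg Subtype.val (mul_left_cancel₀ (pow_ne_zero ℓ hϖ.ne_zero)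
          (hp.zero_one.symm.trans hp'.zero_one))
      · exact congrArg Subtype.val (hp.one_zero.trans hp'.one_zero.symm)
      · exact congrArg Subtype.val (hp.one_one.symm.trans hp'.one_one)
    subst this
    refine hf _ ?_ v
    change IsLocalRing.residue 𝒪[F] (p 1 0) = 0
    rw [hp.one_zero, residue_pow_mul hϖ hℓ]

variable [CharP 𝓀[F] 2]

/-- Conjugation by $w$ makes an upper unipotent `h` lower unipotent, and the corresponding `p'` is
trivial modulo $\varpi$. The intertwiner is therefore $U$-invariant on its source, where $U$ has no
trivial character. -/
theorem conjIntertwiners_weyl (hσ : IsCuspidal σ) (hϖ : Irreducible ϖ) {ℓ : ℕ}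
    (hℓ : ℓ ≠ 0) {a : SL(2, 𝒪[F])}
    (ha : (a : Matrix (Fin 2) (Fin 2) 𝒪[F]) = !![0, 1; -1, 0]) :
    conjIntertwiners σ ϖ ℓ a = ⊥ := by
  rw [eq_bot_iff]
  intro f hf
  refine eq_zero_of_forall_apply_unipotent hσ fun x v => ?_
  obtain ⟨b, rfl⟩ := IsLocalRing.residue_surjective x
  let h' : SL(2, 𝒪[F]) := slOfEntries 1 0 (-(ϖ ^ ℓ * b)) 1 (by ring)
  let p' : SL(2, 𝒪[F]) := slOfEntries 1 0 (ϖ ^ ℓ * -(ϖ ^ ℓ * b)) 1 (by ring)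
  have := hf _ h' _ p' (isDiagConj_upperUnipotent ϖ ℓ b) ⟨rfl, rfl, by simp [h', p'], rfl⟩ (by
    ext i j
    fin_cases i <;> fin_cases j <;>
      simp [ha, h', Matrix.mul_apply, Fin.sum_univ_two]) v
  have hp' : Matrix.SpecialLinearGroup.map (IsLocalRing.residue 𝒪[F]) p' =
      upperUnipotent (0 : 𝓀[F]) :=
    map_residue_eq_upperUnipotent (map_one _) (map_zero _) (residue_pow_mul hϖ hℓ _) (map_one _)
  rwa [map_residue_upperUnipotent, hp', upperUnipotent_zero, map_one,
    Module.End.one_apply] at this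

theorem rank_selfIntertwiners_weyl (hσ : IsCuspidal σ) (hϖ : Irreducible ϖ) {ℓ : ℕ}
    (hℓ : ℓ ≠ 0) : Module.rank ℂ (selfIntertwiners (weyl F) (twisted σ hϖ ℓ)) = 0 := by
  have h := fun a ha => (rank_selfIntertwiners_mapGL σ hϖ ℓ a).trans
    ((congrArg (fun W : Submodule ℂ (V →ₗ[ℂ] V) => Module.rank ℂ W)
      (conjIntertwiners_weyl hσ hϖ hℓ ha)).trans (rank_bot ℂ _))
  exact h _ rfl

/-- Intertwining by a unipotent element amounts to intertwining on the unipotent subgroup, up to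
the translations in `Z`. -/
theorem conjIntertwiners_upperUnipotent (σ : Representation ℂ SL(2, 𝓀[F]) V)
    (hϖ : Irreducible ϖ) {k m : ℕ} (hk : k ≠ 0) (hm : m ≠ 0)
    (α : 𝒪[F]ˣ) (Z : Set 𝓀[F])
    (hZ : ∀ a b c d t : 𝒪[F], a * d - ϖ ^ (k + m) * b * c = 1 →
      a - d = α * ϖ ^ k * c + ϖ ^ m * t → IsLocalRing.residue 𝒪[F] (α * t) ∈ Z)
    (hZ' : ∀ z ∈ Z, ∃ a c d t : 𝒪[F], a * d = 1 ∧ a - d = α * ϖ ^ k * c + ϖ ^ m * t ∧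
      IsLocalRing.residue 𝒪[F] (α * t) = z) :
    conjIntertwiners σ ϖ (k + m) (upperUnipotent ((α : 𝒪[F]) * ϖ ^ k)) =
      relativeCommutant σ Z := by
  have hℓ : k + m ≠ 0 := by omega
  have hres : ∀ a c d t : 𝒪[F], a - d = α * ϖ ^ k * c + ϖ ^ m * t →
      IsLocalRing.residue 𝒪[F] a = IsLocalRing.residue 𝒪[F] d := by
    intro a c d t h
    have h1 := congrArg (IsLocalRing.residue 𝒪[F]) h
    rwa [mul_assoc, mul_left_comm, map_sub, map_add, residue_pow_mul hϖ hk,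
      residue_pow_mul hϖ hm, add_zero, sub_eq_zero] at h1
  refine le_antisymm (fun f hf => ?_) fun f hf h h' p p' hp hp' ha v => ?_
  · refine ⟨fun x v => ?_, fun z hz v => ?_⟩
    · obtain ⟨b, rfl⟩ := IsLocalRing.residue_surjective x
      have := hf _ _ _ _ (isDiagConj_upperUnipotent ϖ (k + m) b)
        (isDiagConj_upperUnipotent ϖ (k + m) b) (by
          ext i j
          fin_cases i <;> fin_cases j <;>
            simp [Matrix.mul_apply, Fin.sum_univ_two, add_comm]) v
      rwa [map_residue_upperUnipotent] at this
    · obtain ⟨a, c, d, t, had, hadt, htz⟩ := hZ' z hz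
      have hr := hres a c d t hadt
      obtain ⟨ha1, hd1⟩ := residue_eq_one_of_mul_eq_one
        (by rw [← map_mul, had, map_one]) hr
      -- A lower triangular `h` isolates the translation: `p` reduces to the identity and `p'` to
      -- $u(z)$.
      let h : SL(2, 𝒪[F]) := slOfEntries a 0 c d (by rw [had]; ring)
      let p : SL(2, 𝒪[F]) := slOfEntries a 0 (ϖ ^ (k + m) * c) d (by rw [had]; ring)
      let h' : SL(2, 𝒪[F]) := slOfEntries (a - α * ϖ ^ k * c) (ϖ ^ (k + m) * (α * t)) c
        (α * ϖ ^ k * c + d) (by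
          rw [pow_add]
          linear_combination had + α * ϖ ^ k * c * hadt)
      let p' : SL(2, 𝒪[F]) := slOfEntries (a - α * ϖ ^ k * c) (α * t) (ϖ ^ (k + m) * c)
        (α * ϖ ^ k * c + d) (by
          rw [pow_add]
          linear_combination had + α * ϖ ^ k * c * hadt)
      have hyc : IsLocalRing.residue 𝒪[F] (α * ϖ ^ k * c) = 0 := by
        rw [mul_assoc, mul_left_comm, residue_pow_mul hϖ hk]
      have hpi : Matrix.SpecialLinearGroup.map (IsLocalRing.residue 𝒪[F]) p =
          upperUnipotent (0 : 𝓀[F]) :=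
        map_residue_eq_upperUnipotent ha1 (map_zero _) (residue_pow_mul hϖ hℓ c) hd1
      have hpi' : Matrix.SpecialLinearGroup.map (IsLocalRing.residue 𝒪[F]) p' =
          upperUnipotent z :=
        map_residue_eq_upperUnipotent
          (by change IsLocalRing.residue 𝒪[F] (a - α * ϖ ^ k * c) = 1
              rw [map_sub, hyc, ha1, sub_zero]) htz (residue_pow_mul hϖ hℓ c)
          (by change IsLocalRing.residue 𝒪[F] (α * ϖ ^ k * c + d) = 1
              rw [map_add, hyc, hd1, zero_add])
      have := hf h h' p p' ⟨rfl, rfl, by simp [h, p], rfl⟩ ⟨rfl, rfl, rfl, rfl⟩ (by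
        ext i j
        fin_cases i <;> fin_cases j <;> refine congrArg Subtype.val ?_ <;>
          simp [h, h', Matrix.mul_apply, Fin.sum_univ_two]
        · rw [pow_add]
          linear_combination α * ϖ ^ k * hadt
        · ring) v
      rw [hpi, hpi', upperUnipotent_zero, map_one, Module.End.one_apply] at this
      exact this.symm
  · have h1 : ∀ i j, (h * upperUnipotent ((α : 𝒪[F]) * ϖ ^ k)) i j =
        (upperUnipotent ((α : 𝒪[F]) * ϖ ^ k) * h') i j := fun i j => by rw [ha]
    have h00 := h1 0 0
    have h01 := h1 0 1
    have h10 := h1 1 0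
    have h11 := h1 1 1
    simp [Matrix.mul_apply, Fin.sum_univ_two] at h00 h01 h10 h11
    have hd := h.det_coe
    rw [Matrix.det_fin_two, hp.zero_one] at hd
    have hinv : (↑α⁻¹ : 𝒪[F]) * α = 1 := α.inv_mul
    -- The upper right entry of `h * a = a * h'`, divided by $\alpha\varpi^k$.
    have hadt : h 0 0 - h 1 1 = α * ϖ ^ k * h 1 0 +
        ϖ ^ m * (↑α⁻¹ * (p' 0 1 - p 0 1)) := by
      have hne : (α : 𝒪[F]) * ϖ ^ k ≠ 0 := mul_ne_zero α.ne_zero (pow_ne_zero _ hϖ.ne_zero)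
      refine mul_left_cancel₀ hne ?_
      have e1 := hp.zero_one
      have e2 := hp'.zero_one
      rw [pow_add] at e1 e2
      linear_combination h01 - e1 + e2 - α * ϖ ^ k * h11 -
        ϖ ^ k * ϖ ^ m * (p' 0 1 - p 0 1) * hinv
    have hr := hres _ _ _ _ hadt
    have hz := hZ (h 0 0) (p 0 1) (h 1 0) (h 1 1) _ hd hadt
    rw [← mul_assoc, α.mul_inv, one_mul] at hz
    have hd2 := congrArg (IsLocalRing.residue 𝒪[F]) hd
    rw [mul_assoc, map_sub, residue_pow_mul hϖ hℓ, sub_zero, map_mul, map_one] at hd2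
    obtain ⟨r00, r11⟩ := residue_eq_one_of_mul_eq_one hd2 hr
    have hyc : IsLocalRing.residue 𝒪[F] (α * ϖ ^ k * h' 1 0) = 0 := by
      rw [mul_assoc, mul_left_comm, residue_pow_mul hϖ hk]
    have r00' : IsLocalRing.residue 𝒪[F] (h' 0 0) = 1 := by
      rw [h00, map_add, hyc, add_zero] at r00
      exact r00
    have r11' : IsLocalRing.residue 𝒪[F] (h' 1 1) = 1 := by
      rw [← h11, h10, mul_comm, map_add, hyc, zero_add, r11]
    have hpi : Matrix.SpecialLinearGroup.map (IsLocalRing.residue 𝒪[F]) p =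
        upperUnipotent (IsLocalRing.residue 𝒪[F] (p 0 1)) :=
      map_residue_eq_upperUnipotent (hp.zero_zero ▸ r00) rfl
        (hp.one_zero ▸ residue_pow_mul hϖ hℓ _) (hp.one_one ▸ r11)
    have hpi' : Matrix.SpecialLinearGroup.map (IsLocalRing.residue 𝒪[F]) p' =
        upperUnipotent (IsLocalRing.residue 𝒪[F] (p 0 1) +
          IsLocalRing.residue 𝒪[F] (p' 0 1 - p 0 1)) :=
      map_residue_eq_upperUnipotent (hp'.zero_zero ▸ r00') (by rw [← map_add]; congr 1; ring)
        (hp'.one_zero ▸ residue_pow_mul hϖ hℓ _) (hp'.one_one ▸ r11')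
    rw [hpi, hpi', hf.1, upperUnipotent_add, map_mul, Module.End.mul_apply, hf.2 _ hz]

theorem rank_selfIntertwiners_gK (hσ : IsCuspidal σ) (hϖ : Irreducible ϖ) {k m : ℕ}
    (hk : k ≠ 0) (hm : m ≠ 0) (α : 𝒪[F]ˣ) (Z : AddSubgroup 𝓀[F])
    (hZ : ∀ a b c d t : 𝒪[F], a * d - ϖ ^ (k + m) * b * c = 1 →
      a - d = α * ϖ ^ k * c + ϖ ^ m * t → IsLocalRing.residue 𝒪[F] (α * t) ∈ Z)
    (hZ' : ∀ z ∈ Z, ∃ a c d t : 𝒪[F], a * d = 1 ∧ a - d = α * ϖ ^ k * c + ϖ ^ m * t ∧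
      IsLocalRing.residue 𝒪[F] (α * t) = z) :
    Module.rank ℂ (selfIntertwiners (gK ϖ k α) (twisted σ hϖ (k + m))) =
      (Nat.card (𝓀[F] ⧸ Z) - 1 : ℕ) := by
  rw [gK, rank_selfIntertwiners_mapGL,
    conjIntertwiners_upperUnipotent σ hϖ hk hm α (Z : Set 𝓀[F]) hZ hZ', rank_relativeCommutant hσ]

/-- If `k > m`, the translations come from the diagonal torus. -/
theorem rank_selfIntertwiners_gK_of_lt (hσ : IsCuspidal σ) (hϖ : Irreducible ϖ) {k m : ℕ}
    (hkm : m < k) (hm : m ≠ 0) (α : 𝒪[F]ˣ) (Z : AddSubgroup 𝓀[F])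
    (hZ : ∀ s t : 𝒪[F], s * (s + 2) = ϖ ^ m * t → IsLocalRing.residue 𝒪[F] (α * t) ∈ Z)
    (hZ' : ∀ z ∈ Z, ∃ s t : 𝒪[F], s * (s + 2) = ϖ ^ m * t ∧
      IsLocalRing.residue 𝒪[F] (α * t) = z) :
    Module.rank ℂ (selfIntertwiners (gK ϖ k α) (twisted σ hϖ (k + m))) =
      (Nat.card (𝓀[F] ⧸ Z) - 1 : ℕ) := by
  obtain ⟨n, rfl⟩ : ∃ n, k = m + (n + 1) := ⟨k - m - 1, by omega⟩
  refine rank_selfIntertwiners_gK hσ hϖ (by omega) hm α Z ?_ ?_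
  · intro a b c d t had hadt
    -- With $s=a-1$ one has $s(s+2)=a^2-1$. Eliminating $d$ through the determinant shows this is
    -- $\varpi^m$ times the given element, whose residue is that of $t$ because $k>m$ and $a\equiv
    -- 1$.
    have h := hZ (a - 1) (a * t + ϖ ^ (n + 1) * (a * α * c + ϖ ^ m * b * c)) (by
      simp only [pow_add] at had hadt ⊢
      linear_combination had + a * hadt)
    have hr : IsLocalRing.residue 𝒪[F] a = IsLocalRing.residue 𝒪[F] d := by
      have h1 := congrArg (IsLocalRing.residue 𝒪[F]) hadt
      rwa [mul_assoc, mul_left_comm, map_sub, map_add, residue_pow_mul hϖ (by omega),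
        residue_pow_mul hϖ hm, add_zero, sub_eq_zero] at h1
    have hd2 := congrArg (IsLocalRing.residue 𝒪[F]) had
    rw [mul_assoc, map_sub, residue_pow_mul hϖ (by omega), sub_zero, map_mul, map_one] at hd2
    have ha := (residue_eq_one_of_mul_eq_one hd2 hr).1
    rwa [map_mul, map_add, residue_pow_mul hϖ (by omega), add_zero, map_mul, ha, one_mul,
      ← map_mul] at h
  · intro z hz
    obtain ⟨s, t, hst, htz⟩ := hZ' z hz
    have hs : IsLocalRing.residue 𝒪[F] s = 0 := by
      have h1 := congrArg (IsLocalRing.residue 𝒪[F]) hst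
      rw [residue_pow_mul hϖ hm, map_mul, map_add, residue_two, add_zero] at h1
      exact mul_self_eq_zero.mp h1
    have hu : IsUnit (1 + s) := by
      rw [← IsLocalRing.residue_ne_zero_iff_isUnit, map_add, hs, add_zero, map_one]
      exact one_ne_zero
    obtain ⟨d, hd⟩ := hu.exists_right_inv
    -- For the diagonal matrix with entries $a=1+s$ and $d=a^{-1}$, $a-d=d(a^2-1)=\varpi^m dt$, and
    -- $d\equiv 1$.
    refine ⟨1 + s, 0, d, d * t, hd, ?_, ?_⟩
    · linear_combination d * hst - (1 + s) * hd
    · have hd1 := congrArg (IsLocalRing.residue 𝒪[F]) hd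
      rw [map_mul, map_add, hs, add_zero, map_one, one_mul] at hd1
      rw [← htz, map_mul, map_mul, map_mul, hd1, one_mul]

theorem rank_selfIntertwiners_gK_of_le (hσ : IsCuspidal σ) (hϖ : Irreducible ϖ) {k m : ℕ}
    (hk : k ≠ 0) (hkm : k ≤ m) (α : 𝒪[F]ˣ) :
    Module.rank ℂ (selfIntertwiners (gK ϖ k α) (twisted σ hϖ (k + m))) = 0 := by
  rw [rank_selfIntertwiners_gK hσ hϖ hk (by omega) α ⊤ (fun _ _ _ _ _ _ _ => trivial),
    card_quotient_top_sub_one, Nat.cast_zero]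
  intro z _
  obtain ⟨b, rfl⟩ := IsLocalRing.residue_surjective z
  obtain ⟨n, rfl⟩ := Nat.exists_eq_add_of_le hkm
  have hinv : (α : 𝒪[F]) * ↑α⁻¹ = 1 := α.mul_inv
  -- Since $k\le m$, the lower left entry can cancel $\varpi^m t$ for any $t$, with $a=d=1$.
  refine ⟨1, -(↑α⁻¹ * ϖ ^ n * (↑α⁻¹ * b)), 1, ↑α⁻¹ * b, by simp, ?_, ?_⟩
  · rw [pow_add]
    linear_combination ϖ ^ k * ϖ ^ n * ↑α⁻¹ * b * hinv
  · rw [← mul_assoc, hinv, one_mul]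

theorem rank_selfIntertwiners_gK_odd (hσ : IsCuspidal σ) (hϖ : Irreducible ϖ) {k m N : ℕ}
    (hkm : m < k) (hN : m + 1 = 2 * N) (h2 : ϖ ^ N ∣ 2) (α : 𝒪[F]ˣ) :
    Module.rank ℂ (selfIntertwiners (gK ϖ k α) (twisted σ hϖ (k + m))) =
      (Nat.card 𝓀[F] - 1 : ℕ) := by
  rw [rank_selfIntertwiners_gK_of_lt hσ hϖ hkm (by omega) α ⊥, ← AddSubgroup.index,
    AddSubgroup.index_bot]
  · intro s t h
    obtain ⟨w, hw⟩ := h2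
    obtain ⟨r, rfl⟩ := pow_dvd_of_mul_add_two hϖ hN.ge hw h
    -- From $2N=m+1$: one factor $\varpi$ is left over in `t`, so its residue vanishes.
    have ht : t = ϖ ^ 1 * (r * (r + w)) := by
      refine mul_left_cancel₀ (pow_ne_zero m hϖ.ne_zero) ?_
      rw [← mul_assoc, ← pow_add, hN, two_mul, pow_add, ← h, hw]
      ring
    rw [AddSubgroup.mem_bot, map_mul, ht, residue_pow_mul hϖ one_ne_zero, mul_zero]
  · rintro z hz
    rw [AddSubgroup.mem_bot] at hz
    exact ⟨0, 0, by simp, by simp [hz]⟩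

/-- The cofactor `w` need not be a unit: this serves both $m=2e$ and even $m<2e$, which differ in
whether the residue of `w` vanishes. -/
theorem rank_selfIntertwiners_gK_even (hσ : IsCuspidal σ) (hϖ : Irreducible ϖ) {k N : ℕ}
    (hkm : 2 * N < k) (hN : N ≠ 0) {w : 𝒪[F]} (hw : 2 = ϖ ^ N * w) (α : 𝒪[F]ˣ) :
    Module.rank ℂ (selfIntertwiners (gK ϖ k α) (twisted σ hϖ (k + 2 * N))) =
      (Nat.card (𝓀[F] ⧸ (artinSchreier (IsLocalRing.residue 𝒪[F] α)
        (IsLocalRing.residue 𝒪[F] w)).range) - 1 : ℕ) := by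
  refine rank_selfIntertwiners_gK_of_lt hσ hϖ hkm (by omega) α _ ?_ ?_
  · intro s t h
    obtain ⟨r, rfl⟩ := pow_dvd_of_mul_add_two hϖ (by omega) hw h
    have ht : t = r * (r + w) := by
      refine mul_left_cancel₀ (pow_ne_zero (2 * N) hϖ.ne_zero) ?_
      rw [← h, hw]
      ring
    refine ⟨IsLocalRing.residue 𝒪[F] r, ?_⟩
    rw [artinSchreier_apply, ht]
    simp only [map_mul, map_add]
    ring
  · rintro _ ⟨r, rfl⟩
    obtain ⟨r, rfl⟩ := IsLocalRing.residue_surjective r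
    refine ⟨ϖ ^ N * r, r ^ 2 + w * r, by rw [hw]; ring, ?_⟩
    rw [artinSchreier_apply]
    simp only [map_mul, map_add, map_pow]

theorem rank_selfIntertwiners_gK_large (hσ : IsCuspidal σ) (hϖ : Irreducible ϖ) {k m e : ℕ}
    (hkm : m < k) (he : 2 * e < m) {w : 𝒪[F]ˣ} (hw : 2 = ϖ ^ e * (w : 𝒪[F])) (α : 𝒪[F]ˣ) :
    Module.rank ℂ (selfIntertwiners (gK ϖ k α) (twisted σ hϖ (k + m))) = 0 := by
  rw [rank_selfIntertwiners_gK_of_lt hσ hϖ hkm (by omega) α ⊤ (fun _ _ _ => trivial),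
    card_quotient_top_sub_one, Nat.cast_zero]
  intro z _
  obtain ⟨b, rfl⟩ := IsLocalRing.residue_surjective z
  obtain ⟨n, rfl⟩ : ∃ n, m = e + e + (n + 1) := ⟨m - e - e - 1, by omega⟩
  have hα : (α : 𝒪[F]) * ↑α⁻¹ = 1 := α.mul_inv
  have hw' : (w : 𝒪[F]) * ↑w⁻¹ = 1 := w.mul_inv
  let r : 𝒪[F] := ↑α⁻¹ * ↑w⁻¹ * b
  -- The exponent is $m-e$, so that $2s=\varpi^m rw$ while $s^2$ is divisible by $\varpi^{m+1}$; `r`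
  -- is chosen to make $\alpha rw=b$.
  refine ⟨ϖ ^ (e + (n + 1)) * r, r * w + ϖ ^ (n + 1) * r ^ 2, ?_, ?_⟩
  · rw [hw]
    ring
  · have h1 : (α : 𝒪[F]) * (r * w + ϖ ^ (n + 1) * r ^ 2) =
        ϖ ^ (n + 1) * (α * r ^ 2) + α * r * w := by ring
    rw [h1, map_add, residue_pow_mul hϖ (by omega), zero_add]
    congr 1
    linear_combination w * ↑w⁻¹ * b * hα + b * hw'

end Intertwiners

/-! ### Divisibility of 2 by powers of the uniformizer. -/

section TwoVal

variable {F : Type*} [Field F] [ValuativeRel F] [TopologicalSpace F]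
  [IsNonarchimedeanLocalField F] {ϖ : 𝒪[F]}

theorem pow_dvd_two_iff (hϖ : Irreducible ϖ) (n : ℕ) : ϖ ^ n ∣ 2 ↔ (n : ℕ∞) ≤ twoVal F := by
  rw [twoVal, ← hϖ.addVal_pow n, IsDiscreteValuationRing.addVal_le_iff_dvd]

theorem exists_two_eq (hϖ : Irreducible ϖ) {n : ℕ} (h : twoVal F = n) :
    ∃ w : 𝒪[F]ˣ, 2 = ϖ ^ n * (w : 𝒪[F]) := by
  rw [twoVal, ← hϖ.addVal_pow n, IsDiscreteValuationRing.addVal_eq_iff_associated] at h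
  obtain ⟨w, hw⟩ := h.symm
  exact ⟨w, hw.symm⟩

theorem coe_lt_two_mul_iff (n : ℕ) (x : ℕ∞) : (n : ℕ∞) < 2 * x ↔ ((n / 2 + 1 : ℕ) : ℕ∞) ≤ x := by
  induction x with
  | top => simp
  | coe x =>
    norm_cast
    omega

end TwoVal
end DepthZero

/-! ### Assembly of the cases. -/

open DepthZero in
theorem theorem5p5 {F : Type*} [Field F] [ValuativeRel F] [TopologicalSpace F]
    [IsNonarchimedeanLocalField F] [CharP 𝓀[F] 2]
    (ϖ : 𝒪[F]) (hϖ : Irreducible ϖ)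
    {V : Type*} [AddCommGroup V] [Module ℂ V]
    (σ : Representation ℂ SL(2, 𝓀[F]) V) (hσ : IsCuspidal σ)
    (ℓ : ℕ) (hℓ : 1 ≤ ℓ)
    (S : ℕ → Set 𝒪[F]ˣ)
    (hS : ∀ k, 1 ≤ k → k < ℓ → IsSquareClassReps (min (ℓ - k) k) (S k))
    (γ : GL (Fin 2) F) (hγ : γ ∈ cosetReps ϖ ℓ S) :
    (γ = 1 → Module.rank ℂ (selfIntertwiners γ (twisted σ hϖ ℓ)) = 1) ∧
    (∀ k, 1 ≤ k → k < ℓ → ∀ α ∈ S k, γ = gK ϖ k α → ℓ < 2 * k →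
      ((ℓ - k : ℕ) : ℕ∞) < 2 * twoVal F → Odd (ℓ - k) →
      Module.rank ℂ (selfIntertwiners γ (twisted σ hϖ ℓ)) = ((Nat.card 𝓀[F] - 1 : ℕ) : Cardinal)) ∧
    (∀ k, 1 ≤ k → k < ℓ → ∀ α ∈ S k, γ = gK ϖ k α → ℓ < 2 * k →
      ((ℓ - k : ℕ) : ℕ∞) = 2 * twoVal F →
      Module.rank ℂ (selfIntertwiners γ (twisted σ hϖ ℓ)) = 1) ∧
    (γ ≠ 1 →
      (¬ ∃ k, 1 ≤ k ∧ k < ℓ ∧ ∃ α ∈ S k, γ = gK ϖ k α ∧ ℓ < 2 * k ∧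
        ((((ℓ - k : ℕ) : ℕ∞) < 2 * twoVal F ∧ Odd (ℓ - k)) ∨
          ((ℓ - k : ℕ) : ℕ∞) = 2 * twoVal F)) →
      Module.rank ℂ (selfIntertwiners γ (twisted σ hϖ ℓ)) = 0) := by
  refine ⟨?_, ?_, ?_, ?_⟩
  · rintro rfl
    rw [← map_one (Matrix.SpecialLinearGroup.mapGL (R := 𝒪[F]) F), rank_selfIntertwiners_mapGL,
      conjIntertwiners_one σ hϖ (by omega), rank_borelCommutant hσ]
  · rintro k hk hkℓ α - rfl h2k hlt ⟨j, hj⟩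
    obtain ⟨m, rfl⟩ := Nat.exists_eq_add_of_lt hkℓ
    -- From here $\ell-k$ is `m + 1`.
    rw [add_assoc] at hj hlt ⊢
    rw [Nat.add_sub_cancel_left] at hj hlt
    rw [coe_lt_two_mul_iff, ← pow_dvd_two_iff hϖ] at hlt
    exact rank_selfIntertwiners_gK_odd hσ hϖ (by omega) (by omega) hlt α
  · rintro k hk hkℓ α - rfl h2k heq
    obtain ⟨m, rfl⟩ := Nat.exists_eq_add_of_lt hkℓ
    rw [add_assoc] at heq ⊢
    rw [Nat.add_sub_cancel_left] at heq
    cases he : twoVal F with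
    | top => simp [he] at heq
    | coe e =>
      rw [he] at heq
      have hm : m + 1 = 2 * e := by exact_mod_cast heq
      obtain ⟨w, hw⟩ := exists_two_eq hϖ he
      rw [hm, rank_selfIntertwiners_gK_even hσ hϖ (by omega) (by omega) hw,
        card_quotient_artinSchreier]
      · simp
      · exact (IsLocalRing.residue_ne_zero_iff_isUnit _).mpr α.isUnit
      · exact (IsLocalRing.residue_ne_zero_iff_isUnit _).mpr w.isUnit
  · intro h1 hno
    rcases hγ with (h | h) | ⟨k, hk, hkℓ, α, hα, rfl⟩
    · exact absurd h h1
    · rw [Set.mem_singleton_iff] at h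
      rw [h]
      exact rank_selfIntertwiners_weyl hσ hϖ (by omega)
    · have hno' := fun h => hno ⟨k, hk, hkℓ, α, hα, rfl, h⟩
      obtain ⟨m, rfl⟩ := Nat.exists_eq_add_of_lt hkℓ
      rw [add_assoc] at hno' ⊢
      rw [Nat.add_sub_cancel_left] at hno'
      by_cases hkm : k ≤ m + 1
      · exact rank_selfIntertwiners_gK_of_le hσ hϖ (by omega) hkm α
      have hno2 : ¬ _ := fun h => hno' ⟨by omega, h⟩
      rw [not_or, not_and, Nat.not_odd_iff_even] at hno2
      rcases lt_trichotomy ((m + 1 : ℕ) : ℕ∞) (2 * twoVal F) with hlt | heq | hgt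
      · obtain ⟨j, hj⟩ := hno2.1 hlt
        rw [← two_mul] at hj
        rw [coe_lt_two_mul_iff, ← pow_dvd_two_iff hϖ, hj, Nat.mul_div_cancel_left _ two_pos]
          at hlt
        obtain ⟨w, hw⟩ := hlt
        -- As $j<e$, the cofactor of $\varpi^j$ in 2 is still divisible by $\varpi$. The
        -- Artin-Schreier map degenerates to $r\mapsto\alpha r^2$, which is onto.
        rw [pow_succ, mul_assoc] at hw
        rw [hj, rank_selfIntertwiners_gK_even hσ hϖ (by omega) (by omega) hw, map_mul,
          (residue_eq_zero_iff_dvd hϖ).mpr dvd_rfl, zero_mul, AddMonoidHom.range_eq_top.mpr,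
          card_quotient_top_sub_one, Nat.cast_zero]
        exact artinSchreier_zero_surjective
          ((IsLocalRing.residue_ne_zero_iff_isUnit _).mpr α.isUnit)
      · exact absurd heq hno2.2
      · cases he : twoVal F with
        | top => simp [he] at hgt
        | coe e =>
          rw [he] at hgt
          obtain ⟨w, hw⟩ := exists_two_eq hϖ he
          exact rank_selfIntertwiners_gK_large hσ hϖ (by omega) (by exact_mod_cast hgt) hw α
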